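/- **Setting.** A *deformation of manifolds* $(\widetilde M,P,\pi)$ consists of a $C^\infty$ manifold $P$ of real dimension $s$, a $C^\infty$ manifold $\widetilde M$ of real dimension $2n+s$, and a surjective $C^\infty$ map $\pi:\widetilde M\to P$, together with a covering of $\widetilde M$ by smooth charts $(z,t):U_\alpha\to D_\alpha\times V_\alpha$ ($D_\alpha\subset\mathbb C^n$, $V_\alpha\subset\mathbb R^s$ open) such that $\pi(U_\alpha)$ is diffeomorphic to $V_\alpha$ by a chart of $P$ in which $\pi$ is the projection $(z,t)\mapsto t$, and such that the changes of coordinates are holomorphic in $z$ for fixed $t$. Put $M_t=\pi^{-1}(t)$, with inclusion $\iota_t:M_t\hookrightarrow\widetilde M$ (so that $T_xM_t=\ker d\pi_x$). Let $\widetilde{\mathcal O}$ be the sheaf of $C^\infty$ complex functions on $\widetilde M$ that are holomorphic along the fibers $M_t$, let $T\pi$ and $\overline{T\pi}$ be the subbundles of $T\widetilde M\otimes\mathbb C$ with local frames $\partial/\partial z_k$ and $\partial/\partial\bar z_k$, and let $\widetilde{\mathcal O}(T\pi)$ be the sheaf of vector fields that are locally of the form $\sum_k f_k\,\partial/\partial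 z_k$ with $f_k\in\widetilde{\mathcal O}$. A *deformation of foliations* is a coherent $\widetilde{\mathcal O}$-submodule $\widetilde{\mathcal F}\subset\widetilde{\mathcal O}(T\pi)$ with $[\widetilde{\mathcal F},\widetilde{\mathcal F}]\subset\widetilde{\mathcal F}$ (coherent: locally there is an exact sequence $\widetilde{\mathcal O}^a\to\widetilde{\mathcal O}^b\to\widetilde{\mathcal F}\to0$). Its singular set $S(\widetilde{\mathcal F})$ is the set of points at which the stalk of $\widetilde{\mathcal O}(T\pi)/\widetilde{\mathcal F}$ is not a free module over the stalk of $\widetilde{\mathcal O}$; it has rank $p$ if its stalks at the points outside $S(\widetilde{\mathcal F})$ are free of rank $p$. An *$\widetilde{\mathcal O}$-bundle* is a $C^\infty$ complex vector bundle $E\to\widetilde M$ of finite rank with a covering family of smooth local frames (the $\widetilde{\mathcal O}$-frames) whose transition matrices have entries in $\widetilde{\mathcal O}$; $\mathcal E$ denotes the sheaf of its sections with coefficients in $\widetilde{\mathcal O}$ with respect to these frames. The operator $\bar\partial_E$, a partial connection along $\overline{T\pi}$ on $C^\infty$ sections of $E$, is given by $\bar\partial_E\big(\sum_j f_je_j\big)=\sum_{j,k}\frac{\partial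 f_j}{\partial\bar z_k}\,d\bar z_k\otimes e_j$ in any $\widetilde{\mathcal O}$-frame $(e_j)$. A *flat partial $\widetilde{\mathcal O}$-connection* for $E$ along $\widetilde{\mathcal F}$ is a morphism of sheaves $(X,\sigma)\mapsto\delta_X\sigma$, $\widetilde{\mathcal F}\times\mathcal E\to\mathcal E$, additive in $X$ and $\mathbb C$-linear in $\sigma$, with $$\delta_{fX}(g\sigma)=f\big(g\,\delta_X\sigma+dg(X)\,\sigma\big)\quad(f,g\in\widetilde{\mathcal O}),\qquad \delta_X\delta_Y-\delta_Y\delta_X-\delta_{[X,Y]}=0 .$$ A $C^\infty$ complex connection $\nabla$ on $E$ *extends* $\delta\oplus\bar\partial_E$ if $\nabla_X\sigma=\delta_X\sigma$ for all $X\in\widetilde{\mathcal F}$, $\sigma\in\mathcal E$, and $\nabla_{\bar v}\sigma=(\bar\partial_E\sigma)(\bar v)$ for all $\bar v\in\overline{T\pi}$ and all $C^\infty$ local sections $\sigma$ of $E$. For a symmetric polynomial $\varphi\in\mathbb C[x_1,\dots,x_N]$ write $\varphi=Q(\mathsf e_1,\dots,\mathsf e_N)$ with $\mathsf e_k$ the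 elementary symmetric polynomials, and put $\varphi(\nabla)=Q(c_1(\nabla),\dots,c_N(\nabla))$, where the Chern forms $c_k(\nabla)$ are defined by $\det\big(1+X\tfrac{\sqrt{-1}}{2\pi}K\big)=\sum_kc_k(\nabla)X^k$, $K$ being the curvature matrix of $\nabla$ (thus $c_k(\nabla)=0$ for $k>\operatorname{rank}E$). **Theorem (relative Bott vanishing).** Let $(\widetilde M,P,\pi)$ be a deformation of manifolds and $\widetilde{\mathcal F}$ a deformation of foliations on $\widetilde M$ of rank $p$ with $S(\widetilde{\mathcal F})=\emptyset$. Let $E$ be an $\widetilde{\mathcal O}$-bundle over $\widetilde M$ and let $\delta$ be a flat partial $\widetilde{\mathcal O}$-connection for $E$ along $\widetilde{\mathcal F}$. Then, for every connection $\nabla$ for $E$ that extends $\delta\oplus\bar\partial_E$, $$\iota_t^*\big(\varphi(\nabla)\big)=0$$ for all $t\in P$ and all homogeneous symmetric polynomials $\varphi$ (in any number of variables) of degree $d>n-p$. -/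

import Mathlib

open Bundle Set TensorProduct
open scoped Manifold ContDiff Topology

noncomputable section

namespace DefFol

/-! ### Complex-valued forms on a real vector space and Chern forms of a matrix of two-forms -/

section Forms

variable (T : Type*) [AddCommGroup T] [Module ℝ T]

/-- The exterior algebra of complex-valued forms on a real vector space `T`, i.e. the exterior
algebra over `ℂ` of `T* ⊗ ℂ = Hom_ℝ(T, ℂ)`. -/
abbrev FormAlg : Type _ := ExteriorAlgebra ℂ (T →ₗ[ℝ] ℂ)

/-- The wedge products `f ∧ g` of two complex-valued one-forms. -/
def wedgePairs : Set (FormAlg T) :=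
  {w | ∃ f g : T →ₗ[ℝ] ℂ, w = ExteriorAlgebra.ι ℂ f * ExteriorAlgebra.ι ℂ g}

theorem wedgePairs_comm :
    ∀ a ∈ wedgePairs T, ∀ b ∈ wedgePairs T, a * b = b * a := by
  rintro _ ⟨f, g, rfl⟩ _ ⟨f', g', rfl⟩
  have key : ∀ a b : T →ₗ[ℝ] ℂ, ExteriorAlgebra.ι ℂ a * ExteriorAlgebra.ι ℂ b
      = - (ExteriorAlgebra.ι ℂ b * ExteriorAlgebra.ι ℂ a) :=
    fun a b => eq_neg_of_add_eq_zero_left (ExteriorAlgebra.ι_add_mul_swap a b)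
  have h1 := key g f'
  have h2 := key g g'
  have h3 := key f f'
  have h4 := key f g'
  generalize ExteriorAlgebra.ι ℂ f = F at *
  generalize ExteriorAlgebra.ι ℂ g = G at *
  generalize ExteriorAlgebra.ι ℂ f' = F' at *
  generalize ExteriorAlgebra.ι ℂ g' = G' at *
  calc F * G * (F' * G') = F * (G * F') * G' := by simp only [mul_assoc]
    _ = -(F * F' * (G * G')) := by rw [h1]; simp only [mul_assoc, mul_neg, neg_mul]
    _ = -(F' * (F * G') * G) := by
        rw [h2, h3]; simp only [mul_assoc, mul_neg, neg_mul, neg_neg]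
    _ = F' * G' * (F * G) := by
        rw [h4]; simp only [mul_assoc, mul_neg, neg_mul, neg_neg]

/-- The algebra of complex-valued forms of even degree: the subalgebra of the exterior algebra
generated by the wedge products of two one-forms. It is commutative. -/
def EvenForms : Subalgebra ℂ (FormAlg T) := Algebra.adjoin ℂ (wedgePairs T)

instance : CommRing (EvenForms T) :=
  { (inferInstance : Ring (EvenForms T)) with
    mul_comm := (Algebra.isMulCommutative_adjoin ℂ (wedgePairs_comm T)).is_comm.comm }

variable {T}

/-- The wedge product of two complex-valued one-forms, as an even form. -/
def wedge (f g : T →ₗ[ℝ] ℂ) : EvenForms T :=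
  ⟨ExteriorAlgebra.ι ℂ f * ExteriorAlgebra.ι ℂ g, Algebra.subset_adjoin ⟨f, g, rfl⟩⟩

/-- The element `½ ∑ᵢⱼ B(eᵢ, eⱼ) eⁱ ∧ eʲ = ∑_{i<j} B(eᵢ, eⱼ) eⁱ ∧ eʲ` of the exterior algebra that
corresponds to an alternating bilinear map `B`; here `e` is a basis of `T` and `eⁱ` the dual
basis (the result does not depend on the basis). -/
def twoForm [FiniteDimensional ℝ T] (B : T → T → ℂ) : EvenForms T :=
  let e := Module.finBasis ℝ T
  (1 / 2 : ℂ) • ∑ i, ∑ j, B (e i) (e j) •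
    wedge (Complex.ofRealCLM.toLinearMap ∘ₗ e.coord i) (Complex.ofRealCLM.toLinearMap ∘ₗ e.coord j)

/-- The `k`-th Chern form of a matrix `Ω` of two-forms:
`det (1 + X · (√-1/2π) Ω) = ∑ₖ cₖ(Ω) Xᵏ`. -/
def chernForm {ι : Type*} [Fintype ι] [DecidableEq ι] (Ω : Matrix ι ι (EvenForms T)) (k : ℕ) :
    EvenForms T :=
  (Matrix.det (1 + (Polynomial.X : Polynomial (EvenForms T)) •
    ((Complex.I / (2 * Real.pi)) • Ω).map Polynomial.C)).coeff k

/-- The form `φ(Ω)`, for a symmetric polynomial `φ`: write `φ = P(e₁, …, e_N)` with `eₖ` the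
elementary symmetric polynomials; then `φ(Ω) = P(c₁(Ω), …, c_N(Ω))`. -/
def symmForm {ι : Type*} [Fintype ι] [DecidableEq ι] (Ω : Matrix ι ι (EvenForms T))
    {N : ℕ} (φ : MvPolynomial (Fin N) ℂ) (hφ : φ.IsSymmetric) : EvenForms T :=
  MvPolynomial.aeval (fun k : Fin N => chernForm Ω (k + 1))
    ((MvPolynomial.esymmAlgEquiv (Fin N) ℂ (Fintype.card_fin N)).symm ⟨φ, hφ⟩)

/-- Restriction (pull-back) of complex-valued forms on `T` to a real subspace `W`. -/
def restrictForm (W : Submodule ℝ T) : FormAlg T →ₐ[ℂ] FormAlg W :=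
  ExteriorAlgebra.map
    { toFun := fun f => f ∘ₗ W.subtype
      map_add' := fun _ _ => rfl
      map_smul' := fun _ _ => rfl }

end Forms

/-! ### Deformations of manifolds -/

/-- The model space `ℂⁿ × ℝˢ`, with coordinates `(z, t)`. -/
abbrev Model (n s : ℕ) : Type := (Fin n → ℂ) × EuclideanSpace ℝ (Fin s)

/-- The model with corners of real manifolds modelled on `ℂⁿ × ℝˢ`. -/
abbrev MI (n s : ℕ) : ModelWithCorners ℝ (Model n s) (Model n s) := 𝓘(ℝ, Model n s)

/-- A deformation of manifolds: a smooth surjection `π = proj : M → P` from a smooth manifold of real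
dimension `2n + s` to a smooth manifold of real dimension `s`, with an adapted covering by charts
`(z, t)` with values in `ℂⁿ × ℝˢ`. -/
structure Deformation (n s : ℕ) (M : Type*) [TopologicalSpace M] [ChartedSpace (Model n s) M]
    [IsManifold (MI n s) ∞ M] (P : Type*) [TopologicalSpace P]
    [ChartedSpace (EuclideanSpace ℝ (Fin s)) P] [IsManifold (𝓡 s) ∞ P] where
  /-- The projection to the parameter space. -/
  proj : M → P
  contMDiff : ContMDiff (MI n s) (𝓡 s) ∞ proj
  surjective : Function.Surjective proj
  /-- The adapted charts; they are charts of the smooth manifold `M`. -/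
  charts : Set (OpenPartialHomeomorph M (Model n s))
  charts_subset : charts ⊆ IsManifold.maximalAtlas (MI n s) ∞ M
  cover : ∀ x : M, ∃ φ ∈ charts, x ∈ φ.source
  /-- The chart maps onto `D × V`, the image of its domain in `P` is the domain of a chart `ψ` of
  `P` with image `V`, and in these charts `π` is the projection `D × V → V`. -/
  product : ∀ φ ∈ charts, ∃ (D : Set (Fin n → ℂ)) (V : Set (EuclideanSpace ℝ (Fin s))),
    IsOpen D ∧ IsOpen V ∧ φ.target = D ×ˢ V ∧
    ∃ ψ ∈ IsManifold.maximalAtlas (𝓡 s) ∞ P, ψ.source = proj '' φ.source ∧ ψ.target = V ∧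
      ∀ x ∈ φ.source, ψ (proj x) = (φ x).2
  /-- The changes of charts are holomorphic in `z` for fixed `t`. -/
  holomorphic : ∀ φ ∈ charts, ∀ φ' ∈ charts, ∀ t : EuclideanSpace ℝ (Fin s),
    DifferentiableOn ℂ (fun z : Fin n → ℂ => (φ' (φ.symm (z, t))).1)
      {z | (z, t) ∈ φ.target ∧ φ.symm (z, t) ∈ φ'.source}

section Tangent

variable {n s : ℕ} {M : Type*} [TopologicalSpace M] [ChartedSpace (Model n s) M]

instance (x : M) : FiniteDimensional ℝ (TangentSpace (MI n s) x) :=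
  inferInstanceAs (FiniteDimensional ℝ (Model n s))

variable (n s) in
/-- The complexified tangent space `T_x M ⊗ ℂ`. -/
abbrev CTangent (x : M) : Type := ℂ ⊗[ℝ] TangentSpace (MI n s) x

/-- The derivative `dg(X)` of a complex-valued function along a complex tangent vector. -/
def cderiv (g : M → ℂ) (x : M) : CTangent n s x →ₗ[ℂ] ℂ :=
  LinearMap.liftBaseChange ℂ (mvfderiv (MI n s) g x).toLinearMap

/-- The real part of a complex tangent vector. -/
def reT (x : M) : CTangent n s x →ₗ[ℝ] TangentSpace (MI n s) x :=
  TensorProduct.lift (LinearMap.lsmul ℝ (TangentSpace (MI n s) x) ∘ₗ Complex.reLm)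

/-- The imaginary part of a complex tangent vector. -/
def imT (x : M) : CTangent n s x →ₗ[ℝ] TangentSpace (MI n s) x :=
  TensorProduct.lift (LinearMap.lsmul ℝ (TangentSpace (MI n s) x) ∘ₗ Complex.imLm)

/-- The Lie bracket of complex vector fields, i.e. the complex bilinear extension of the Lie
bracket: `[A + iB, A' + iB'] = [A, A'] - [B, B'] + i([A, B'] + [B, A'])`. -/
def cbracket (X Y : Π x : M, CTangent n s x) (x : M) : CTangent n s x :=
  let A : Π x : M, TangentSpace (MI n s) x := fun y => reT y (X y)
  let B : Π x : M, TangentSpace (MI n s) x := fun y => imT y (X y)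
  let A' : Π x : M, TangentSpace (MI n s) x := fun y => reT y (Y y)
  let B' : Π x : M, TangentSpace (MI n s) x := fun y => imT y (Y y)
  (1 : ℂ) ⊗ₜ[ℝ] (VectorField.mlieBracket (MI n s) A A' x - VectorField.mlieBracket (MI n s) B B' x)
  + Complex.I ⊗ₜ[ℝ]
    (VectorField.mlieBracket (MI n s) A B' x + VectorField.mlieBracket (MI n s) B A' x)

/-- The real tangent vector at `x` whose components in the chart `φ` are `(a, 0)`. -/
def chartVec (φ : OpenPartialHomeomorph M (Model n s)) (x : M) (a : Fin n → ℂ) :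
    TangentSpace (MI n s) x :=
  (mfderiv (MI n s) 𝓘(ℝ, Model n s) φ x).inverse ((a, 0) : Model n s)

/-- `∂/∂zₖ = ½ (∂/∂xₖ - i ∂/∂yₖ)` at `x`, in the chart `φ` with coordinates `z = x + iy`. -/
def ddz (φ : OpenPartialHomeomorph M (Model n s)) (k : Fin n) (x : M) : CTangent n s x :=
  (1 / 2 : ℂ) • ((1 : ℂ) ⊗ₜ[ℝ] chartVec φ x (Pi.single k 1)
    - Complex.I ⊗ₜ[ℝ] chartVec φ x (Pi.single k Complex.I))

/-- `∂/∂z̄ₖ = ½ (∂/∂xₖ + i ∂/∂yₖ)` at `x`, in the chart `φ` with coordinates `z = x + iy`. -/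
def ddzbar (φ : OpenPartialHomeomorph M (Model n s)) (k : Fin n) (x : M) : CTangent n s x :=
  (1 / 2 : ℂ) • ((1 : ℂ) ⊗ₜ[ℝ] chartVec φ x (Pi.single k 1)
    + Complex.I ⊗ₜ[ℝ] chartVec φ x (Pi.single k Complex.I))

end Tangent

namespace Deformation

variable {n s : ℕ} {M : Type*} [TopologicalSpace M] [ChartedSpace (Model n s) M]
  [IsManifold (MI n s) ∞ M] {P : Type*} [TopologicalSpace P]
  [ChartedSpace (EuclideanSpace ℝ (Fin s)) P] [IsManifold (𝓡 s) ∞ P]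
  (D : Deformation n s M P)

/-- `f ∈ Õ(U)`: `f` is a smooth function on the open set `U`, holomorphic along the fibers of `π`.
(Only the values of `f` on `U` matter.) -/
structure IsO (U : Set M) (f : M → ℂ) : Prop where
  smooth : ContMDiffOn (MI n s) 𝓘(ℝ, ℂ) ∞ f U
  holomorphic : ∀ φ ∈ D.charts, ∀ t : EuclideanSpace ℝ (Fin s),
    DifferentiableOn ℂ (fun z : Fin n → ℂ => f (φ.symm (z, t)))
      {z | (z, t) ∈ φ.target ∧ φ.symm (z, t) ∈ U}

/-- `X ∈ Õ(Tπ)(U)`: in every adapted chart, `X = ∑ fₖ ∂/∂zₖ` on `U` with coefficients in `Õ`. -/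
def IsOField (U : Set M) (X : Π x : M, CTangent n s x) : Prop :=
  ∀ φ ∈ D.charts, ∃ f : Fin n → M → ℂ, (∀ k, D.IsO (U ∩ φ.source) (f k)) ∧
    ∀ x ∈ U ∩ φ.source, X x = ∑ k, f k x • ddz φ k x

/-- `f` represents an element of the stalk of `Õ` at `x`. -/
def OGerm (x : M) (f : M → ℂ) : Prop := ∃ U : Set M, IsOpen U ∧ x ∈ U ∧ D.IsO U f

/-- The real tangent space of the fiber `π⁻¹(π(x))` at `x`, i.e. the kernel of `dπ`, which is the
image of the differential of the inclusion of the fiber into `M`. -/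
def vertical (x : M) : Submodule ℝ (TangentSpace (MI n s) x) :=
  LinearMap.ker (mfderiv (MI n s) (𝓡 s) D.proj x).toLinearMap

end Deformation

/-! ### Deformations of foliations -/

section Foliation

variable {n s : ℕ} {M : Type*} [TopologicalSpace M] [ChartedSpace (Model n s) M]
  [IsManifold (MI n s) ∞ M] {P : Type*} [TopologicalSpace P]
  [ChartedSpace (EuclideanSpace ℝ (Fin s)) P] [IsManifold (𝓡 s) ∞ P]

/-- A deformation of foliations: a coherent `Õ`-submodule (subsheaf) of `Õ(Tπ)` that is closed
under the Lie bracket. A section over `U` is given by a complex vector field on `M` of which only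
the values on `U` matter. -/
structure Foliation (D : Deformation n s M P) where
  /-- The sections over an open set. -/
  sec : TopologicalSpace.Opens M → Set (Π x : M, CTangent n s x)
  isOField : ∀ U, ∀ X ∈ sec U, D.IsOField U X
  congr : ∀ U, ∀ X ∈ sec U, ∀ Y : Π x : M, CTangent n s x, (∀ x ∈ U, X x = Y x) → Y ∈ sec U
  restrict : ∀ U V : TopologicalSpace.Opens M, V ≤ U → sec U ⊆ sec V
  glue : ∀ (U : TopologicalSpace.Opens M) (X : Π x : M, CTangent n s x),
    (∀ x ∈ U, ∃ V : TopologicalSpace.Opens M, V ≤ U ∧ x ∈ V ∧ X ∈ sec V) → X ∈ sec U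
  zero_mem : ∀ U, (fun _ => 0) ∈ sec U
  add_mem : ∀ U, ∀ X ∈ sec U, ∀ Y ∈ sec U, (fun x => X x + Y x) ∈ sec U
  smul_mem : ∀ U : TopologicalSpace.Opens M, ∀ f : M → ℂ, D.IsO U f → ∀ X ∈ sec U,
    (fun x => f x • X x) ∈ sec U
  bracket_mem : ∀ U, ∀ X ∈ sec U, ∀ Y ∈ sec U, cbracket X Y ∈ sec U
  /-- Near every point there is an exact sequence `Õᵃ → Õᵇ → 𝓕 → 0`: finitely many sections `X`
  generate, and finitely many relations `R` generate all the relations between them. -/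
  coherent : ∀ x : M, ∃ U : TopologicalSpace.Opens M, x ∈ U ∧ ∃ (a b : ℕ)
    (R : Fin a → Fin b → M → ℂ) (X : Fin b → Π x : M, CTangent n s x),
    (∀ i j, D.IsO U (R i j)) ∧ (∀ j, X j ∈ sec U) ∧
    (∀ i, ∀ y ∈ U, ∑ j, R i j y • X j y = 0) ∧
    (∀ y ∈ U, ∀ V : TopologicalSpace.Opens M, V ≤ U → y ∈ V → ∀ Y ∈ sec V,
      ∃ W : TopologicalSpace.Opens M, W ≤ V ∧ y ∈ W ∧ ∃ g : Fin b → M → ℂ,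
        (∀ j, D.IsO W (g j)) ∧ ∀ w ∈ W, Y w = ∑ j, g j w • X j w) ∧
    (∀ y ∈ U, ∀ V : TopologicalSpace.Opens M, V ≤ U → y ∈ V → ∀ g : Fin b → M → ℂ,
      (∀ j, D.IsO V (g j)) → (∀ w ∈ V, ∑ j, g j w • X j w = 0) →
      ∃ W : TopologicalSpace.Opens M, W ≤ V ∧ y ∈ W ∧ ∃ h : Fin a → M → ℂ,
        (∀ i, D.IsO W (h i)) ∧ ∀ w ∈ W, ∀ j, g j w = ∑ i, h i w * R i j w)

namespace Foliation

variable {D : Deformation n s M P} (𝓕 : Foliation D)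

/-- `X` represents an element of the stalk of `𝓕` at `x`. -/
def Germ (x : M) (X : Π x : M, CTangent n s x) : Prop :=
  ∃ U : TopologicalSpace.Opens M, x ∈ U ∧ X ∈ 𝓕.sec U

/-- The stalk at `x` of the normal sheaf `Õ(Tπ)/𝓕` is a free module over the stalk of `Õ`: there
are germs `e₁, …, e_m` of sections of `Õ(Tπ)` whose classes modulo the stalk of `𝓕` generate and
are linearly independent over the stalk of `Õ`. (This stalk is a finitely generated module, so
that a basis is finite.) -/
def NormalFree (x : M) : Prop :=
  ∃ (m : ℕ) (e : Fin m → Π x : M, CTangent n s x),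
    (∀ i, ∃ U : Set M, IsOpen U ∧ x ∈ U ∧ D.IsOField U (e i)) ∧
    (∀ (U : Set M) (Y : Π x : M, CTangent n s x), IsOpen U → x ∈ U → D.IsOField U Y →
      ∃ g : Fin m → M → ℂ, (∀ i, D.OGerm x (g i)) ∧
        𝓕.Germ x (fun y => Y y - ∑ i, g i y • e i y)) ∧
    (∀ g : Fin m → M → ℂ, (∀ i, D.OGerm x (g i)) → 𝓕.Germ x (fun y => ∑ i, g i y • e i y) →
      ∀ i, ∀ᶠ y in 𝓝 x, g i y = 0)

/-- The singular set: the points at which the stalk of the normal sheaf is not free. -/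
def singularSet : Set M := {x | ¬ 𝓕.NormalFree x}

/-- `𝓕` has rank `p`: at every non-singular point the stalk of `𝓕` is free of rank `p` over the
stalk of `Õ`, i.e. it has a basis `X₁, …, X_p`. -/
def HasRank (p : ℕ) : Prop :=
  ∀ x ∉ 𝓕.singularSet, ∃ X : Fin p → Π x : M, CTangent n s x,
    (∀ i, 𝓕.Germ x (X i)) ∧
    (∀ Y : Π x : M, CTangent n s x, 𝓕.Germ x Y → ∃ g : Fin p → M → ℂ, (∀ i, D.OGerm x (g i)) ∧
      ∀ᶠ y in 𝓝 x, Y y = ∑ i, g i y • X i y) ∧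
    (∀ g : Fin p → M → ℂ, (∀ i, D.OGerm x (g i)) → (∀ᶠ y in 𝓝 x, ∑ i, g i y • X i y = 0) →
      ∀ i, ∀ᶠ y in 𝓝 x, g i y = 0)

end Foliation

end Foliation

/-! ### `Õ`-bundles, connections and flat partial `Õ`-connections -/

section Bundles

variable {n s : ℕ} {M : Type*} [TopologicalSpace M] [ChartedSpace (Model n s) M]
  [IsManifold (MI n s) ∞ M] {P : Type*} [TopologicalSpace P]
  [ChartedSpace (EuclideanSpace ℝ (Fin s)) P] [IsManifold (𝓡 s) ∞ P]
  (F : Type*) [NormedAddCommGroup F] [NormedSpace ℂ F]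
  (E : M → Type*) [TopologicalSpace (TotalSpace F E)] [∀ x, AddCommGroup (E x)]
  [∀ x, Module ℂ (E x)] [∀ x, TopologicalSpace (E x)] [FiberBundle F E]

/-- The section `σ` of `E` is smooth on `U`. -/
def SmoothSecOn (U : Set M) (σ : Π x : M, E x) : Prop :=
  ContMDiffOn (MI n s) ((MI n s).prod 𝓘(ℝ, F)) ∞ (fun x => TotalSpace.mk' F x (σ x)) U

/-- The structure of an `Õ`-bundle on a smooth complex vector bundle `E` of rank `r`: a family of
smooth frames `(U, e₁, …, e_r)` over open sets that cover `M`, with transition matrices whose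
entries are sections of `Õ`. -/
structure OBundle (D : Deformation n s M P) where
  /-- The distinguished `Õ`-frames. -/
  frames : Set (TopologicalSpace.Opens M × (Fin (Module.finrank ℂ F) → Π x : M, E x))
  cover : ∀ x : M, ∃ e ∈ frames, x ∈ e.1
  smooth : ∀ e ∈ frames, ∀ j, SmoothSecOn F E (n := n) (s := s) e.1 (e.2 j)
  linearIndependent : ∀ e ∈ frames, ∀ x ∈ e.1, LinearIndependent ℂ (fun j => e.2 j x)
  span_eq_top : ∀ e ∈ frames, ∀ x ∈ e.1, Submodule.span ℂ (range fun j => e.2 j x) = ⊤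
  transition : ∀ e ∈ frames, ∀ e' ∈ frames,
    ∃ g : Fin (Module.finrank ℂ F) → Fin (Module.finrank ℂ F) → M → ℂ,
      (∀ i j, D.IsO ((e.1 : Set M) ∩ e'.1) (g i j)) ∧
      ∀ x ∈ (e.1 : Set M) ∩ e'.1, ∀ j, e'.2 j x = ∑ i, g i j x • e.2 i x

variable {F E}

/-- `σ` is an `Õ`-section of `E` over `U`: its coefficients in every `Õ`-frame are in `Õ`. -/
def OBundle.IsOSec {D : Deformation n s M P} (𝓔 : OBundle F E D) (U : Set M) (σ : Π x : M, E x) :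
    Prop :=
  ∀ e ∈ 𝓔.frames, ∃ f : Fin (Module.finrank ℂ F) → M → ℂ,
    (∀ j, D.IsO (U ∩ e.1) (f j)) ∧ ∀ x ∈ U ∩ e.1, σ x = ∑ j, f j x • e.2 j x

/-- A flat partial `Õ`-connection for `E` along `𝓕`: a morphism of sheaves that sends sections
`X` of `𝓕` and `σ` of `Õ(E)` over an open set `U` to an `Õ`-section `δ_X σ` over `U`, `Õ`-linear
in `X`, additive in `σ`, with the Leibniz rule and with vanishing curvature. (The values of
`toFun` on other arguments are irrelevant.) -/
structure FlatPartialConnection {D : Deformation n s M P} (𝓕 : Foliation D) (𝓔 : OBundle F E D)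
    where
  /-- The map `(X, σ) ↦ δ_X σ`. -/
  toFun : (Π x : M, CTangent n s x) → (Π x : M, E x) → Π x : M, E x
  congr : ∀ (U : TopologicalSpace.Opens M), ∀ X ∈ 𝓕.sec U, ∀ X' ∈ 𝓕.sec U,
    ∀ σ σ' : Π x : M, E x, 𝓔.IsOSec U σ → 𝓔.IsOSec U σ' → (∀ x ∈ U, X x = X' x) → (∀ x ∈ U, σ x = σ' x) →
      ∀ x ∈ U, toFun X σ x = toFun X' σ' x
  isOSec : ∀ (U : TopologicalSpace.Opens M), ∀ X ∈ 𝓕.sec U, ∀ σ : Π x : M, E x,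
    𝓔.IsOSec U σ → 𝓔.IsOSec U (toFun X σ)
  add_left : ∀ (U : TopologicalSpace.Opens M), ∀ X ∈ 𝓕.sec U, ∀ X' ∈ 𝓕.sec U,
    ∀ σ : Π x : M, E x, 𝓔.IsOSec U σ → ∀ x ∈ U,
      toFun (fun y => X y + X' y) σ x = toFun X σ x + toFun X' σ x
  add_right : ∀ (U : TopologicalSpace.Opens M), ∀ X ∈ 𝓕.sec U, ∀ σ σ' : Π x : M, E x,
    𝓔.IsOSec U σ → 𝓔.IsOSec U σ' → ∀ x ∈ U,
      toFun X (fun y => σ y + σ' y) x = toFun X σ x + toFun X σ' x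
  leibniz : ∀ (U : TopologicalSpace.Opens M), ∀ X ∈ 𝓕.sec U, ∀ σ : Π x : M, E x,
    𝓔.IsOSec U σ → ∀ f g : M → ℂ, D.IsO U f → D.IsO U g → ∀ x ∈ U,
      toFun (fun y => f y • X y) (fun y => g y • σ y) x
        = f x • (g x • toFun X σ x + cderiv g x (X x) • σ x)
  flat : ∀ (U : TopologicalSpace.Opens M), ∀ X ∈ 𝓕.sec U, ∀ Y ∈ 𝓕.sec U, ∀ σ : Π x : M, E x,
    𝓔.IsOSec U σ → ∀ x ∈ U,
      toFun X (toFun Y σ) x - toFun Y (toFun X σ) x - toFun (cbracket X Y) σ x = 0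

variable [∀ x, IsTopologicalAddGroup (E x)] [∀ x, ContinuousSMul ℝ (E x)]
  [VectorBundle ℝ F E]

variable (n s F E) in
/-- A smooth connection on the smooth complex vector bundle `E`: a covariant derivative which is
complex linear (it satisfies the Leibniz rule for complex-valued functions) and which maps smooth
local sections of `E` to smooth local sections of `Hom(TM, E)`. -/
structure Connection extends CovariantDerivative (MI n s) F E where
  leibniz_complex : ∀ (σ : Π x : M, E x) (g : M → ℂ) (x : M),
    MDifferentiableAt (MI n s) ((MI n s).prod 𝓘(ℝ, F)) (fun y => TotalSpace.mk' F y (σ y)) x →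
    MDifferentiableAt (MI n s) 𝓘(ℝ, ℂ) g x → ∀ u : TangentSpace (MI n s) x,
      toFun (fun y => g y • σ y) x u = g x • toFun σ x u + mvfderiv (MI n s) g x u • σ x
  smooth : ∀ U : Set M, IsOpen U → ContMDiffCovariantDerivativeOn F ∞ toFun U

namespace Connection

variable (nabla : Connection n s F E)

/-- `∇_w σ` at `x`, for a complex tangent vector `w`. -/
def along (σ : Π x : M, E x) (x : M) : CTangent n s x →ₗ[ℂ] E x :=
  LinearMap.liftBaseChange ℂ (nabla.toFun σ x).toLinearMap

/-- The curvature `K(u, v)ε = ∇_X ∇_Y σ - ∇_Y ∇_X σ - ∇_[X,Y] σ`, computed with extensions `X`, `Y`,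
`σ` of `u`, `v`, `ε` which are smooth near the point (it does not depend on the extensions). -/
def curvature {x : M} (u v : TangentSpace (MI n s) x) (ε : E x) : E x :=
  let X : Π y : M, TangentSpace (MI n s) y := FiberBundle.extend (Model n s) u
  let Y : Π y : M, TangentSpace (MI n s) y := FiberBundle.extend (Model n s) v
  let σ : Π y : M, E y := FiberBundle.extend F ε
  nabla.toFun (fun y => nabla.toFun σ y (Y y)) x (X x)
    - nabla.toFun (fun y => nabla.toFun σ y (X y)) x (Y x)
    - nabla.toFun σ x (VectorField.mlieBracket (MI n s) X Y x)

/-- The curvature matrix of `∇` at `x` with respect to a basis of `E_x`. -/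
def curvatureMatrix {ι : Type*} {x : M} (b : Module.Basis ι ℂ (E x)) :
    Matrix ι ι (EvenForms (TangentSpace (MI n s) x)) :=
  Matrix.of fun i j => twoForm fun u v => b.repr (nabla.curvature u v (b j)) i

/-- The value at `x` of the characteristic form `φ(∇)`, computed with a basis of `E_x` (it does not
depend on the basis). -/
def charForm {ι : Type*} [Fintype ι] [DecidableEq ι] {x : M} (b : Module.Basis ι ℂ (E x))
    {N : ℕ} (φ : MvPolynomial (Fin N) ℂ) (hφ : φ.IsSymmetric) :
    EvenForms (TangentSpace (MI n s) x) :=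
  symmForm (nabla.curvatureMatrix b) φ hφ

/-- `∇` extends `δ ⊕ ∂̄_E`. A partial connection along `F ⊕ T̄π` is determined by the following
values:
* `∇_X σ = δ_X σ` for all sections `X` of `𝓕` and `Õ`-sections `σ` of `E`;
* `∇_{∂/∂z̄ₖ} (∑ⱼ fⱼ eⱼ) = ∑ⱼ (∂fⱼ/∂z̄ₖ) eⱼ` for `Õ`-frames `e` and smooth functions `fⱼ`. -/
structure Extends {D : Deformation n s M P} {𝓕 : Foliation D} {𝓔 : OBundle F E D}
    (δ : FlatPartialConnection 𝓕 𝓔) : Prop where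
  delta : ∀ (U : TopologicalSpace.Opens M), ∀ X ∈ 𝓕.sec U, ∀ σ : Π x : M, E x, 𝓔.IsOSec U σ →
    ∀ x ∈ U, nabla.along σ x (X x) = δ.toFun X σ x
  dbar : ∀ (U : TopologicalSpace.Opens M), ∀ φ ∈ D.charts, ∀ e ∈ 𝓔.frames,
    (U : Set M) ⊆ φ.source ∩ e.1 → ∀ f : Fin (Module.finrank ℂ F) → M → ℂ,
    (∀ j, ContMDiffOn (MI n s) 𝓘(ℝ, ℂ) ∞ (f j) U) → ∀ x ∈ U, ∀ k : Fin n,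
      nabla.along (fun y => ∑ j, f j y • e.2 j y) x (ddzbar φ k x)
        = ∑ j, cderiv (f j) x (ddzbar φ k x) • e.2 j x

end Connection

end Bundles

end DefFol

namespace DefFol

/-! ### Powers of ideals and Chern forms -/

/-! The curvature of `∇`, extended complex bilinearly, vanishes on pairs of vectors from `𝓕` and the
antiholomorphic directions. It can be tested on `Õ`-sections `σ`, where `∇` is prescribed. Two
sections of `𝓕` give zero because `δ` is flat. Antiholomorphic derivatives kill `σ` by the
Cauchy–Riemann equations and the fields `∂/∂z̄ₖ` commute, which settles a pair of these. In the
mixed case `δ_X σ` is again an `Õ`-section, so it is also killed, and `[X, ∂/∂z̄ₖ] = 0` because the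
coefficients of `X` are holomorphic along the fibers (`Extends.complexify₂_curvLin_eq_zero`).

At a nonsingular point, bases of the stalks of the normal sheaf and of `𝓕` combine into a family
that spans the holomorphic vertical vectors, with `m` normal members and `m + p ≤ n`
(`Foliation.exists_adapted`). The coordinates along the normal members are one-forms `θ₁, …, θ_m` on
the tangent space of the fiber. A two-form that vanishes on pairs of the remaining directions is a
sum of terms `θₐ ∧ η` (`restrictEven_twoForm_mem`), so the restricted curvature matrix has entries
in the ideal generated by such products.

The `d`-th power of this ideal is zero for `d > m`, by the pigeonhole principle (`wedgeIdeal_pow`).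
A homogeneous symmetric polynomial of degree `d` is isobaric of weight `d` in the Chern forms, and
`cₖ` lies in the `k`-th power of any ideal that contains the matrix entries (`symmForm_mem_pow`).
Hence `φ(∇)` restricts to an element of a zero ideal as soon as `d > n - p ≥ m`.

The longest part is the passage between real and complex data. Tensoriality of the curvature allows
free choice of the extensions, and `ccurv_eq` identifies the curvature computed with complex fields
with the complexified tensor at a point. -/

/-- The Rees algebra of `I` consists of the polynomials whose coefficient of `X ^ k` lies in `I ^ k`
for every `k`. It is a subalgebra, so it contains the determinant once it contains the entries. -/
theorem coeff_det_one_add_X_smul_mem {R ι : Type*} [CommRing R] [Fintype ι] [DecidableEq ι]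
    (I : Ideal R) (M : Matrix ι ι R) (hM : ∀ i j, M i j ∈ I) (k : ℕ) :
    (Matrix.det (1 + (Polynomial.X : Polynomial R) • M.map Polynomial.C)).coeff k ∈ I ^ k := by
  have hdet : Matrix.det (1 + (Polynomial.X : Polynomial R) • M.map Polynomial.C)
      ∈ reesAlgebra I := by
    rw [Matrix.det_apply]
    refine Subalgebra.sum_mem _ fun σ _ => ?_
    have hp : (∏ i, (1 + (Polynomial.X : Polynomial R) • M.map Polynomial.C) (σ i) i)
        ∈ reesAlgebra I := by
      refine Subalgebra.prod_mem _ fun i _ => ?_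
      rw [Matrix.add_apply, Matrix.smul_apply, Matrix.map_apply, smul_eq_mul]
      refine Subalgebra.add_mem _ ?_ ?_
      · rw [Matrix.one_apply]
        split_ifs
        · exact Subalgebra.one_mem _
        · exact Subalgebra.zero_mem _
      · rw [mul_comm, ← pow_one (Polynomial.X : Polynomial R),
          Polynomial.C_mul_X_pow_eq_monomial]
        exact reesAlgebra.monomial_mem.2 (by simpa using hM _ _)
    rcases Int.units_eq_one_or (Equiv.Perm.sign σ) with h | h
    · rw [h, one_smul]; exact hp
    · rw [h, Units.neg_smul, one_smul]; exact Subalgebra.neg_mem _ hp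
  exact (mem_reesAlgebra_iff I _).1 hdet k

/-- A monomial with exponents `s` is sent into `I` to the power `∑ w k * s k`, which is `d` for
every monomial that occurs in `Q`. -/
theorem aeval_mem_pow_of_isWeightedHomogeneous {σ K R : Type*} [CommRing K]
    [CommRing R] [Algebra K R] (I : Ideal R) (w : σ → ℕ) (c : σ → R) (hc : ∀ k, c k ∈ I ^ w k)
    {Q : MvPolynomial σ K} {d : ℕ} (hQ : MvPolynomial.IsWeightedHomogeneous w Q d) :
    MvPolynomial.aeval c Q ∈ I ^ d := by
  rw [MvPolynomial.aeval_def, MvPolynomial.eval₂_eq]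
  refine Ideal.sum_mem _ fun s hs => Ideal.mul_mem_left _ _ ?_
  rw [← hQ (MvPolynomial.mem_support_iff.1 hs), Finsupp.weight_apply, Finsupp.sum,
    ← Finset.prod_pow_eq_pow_sum]
  refine Ideal.prod_mem_prod fun k _ => ?_
  rw [smul_eq_mul, mul_comm, pow_mul]
  exact Ideal.pow_mem_pow (hc k) _

theorem isHomogeneous_aeval_of_isWeightedHomogeneous {σ τ K : Type*} [CommRing K] (w : σ → ℕ)
    (f : σ → MvPolynomial τ K) (hf : ∀ k, (f k).IsHomogeneous (w k))
    {Q : MvPolynomial σ K} {d : ℕ} (hQ : MvPolynomial.IsWeightedHomogeneous w Q d) :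
    (MvPolynomial.aeval f Q).IsHomogeneous d := by
  rw [MvPolynomial.aeval_def, MvPolynomial.eval₂_eq]
  refine MvPolynomial.IsHomogeneous.sum _ _ _ fun s hs => ?_
  rw [MvPolynomial.algebraMap_eq]
  refine MvPolynomial.IsHomogeneous.C_mul ?_ _
  rw [← hQ (MvPolynomial.mem_support_iff.1 hs), Finsupp.weight_apply, Finsupp.sum]
  refine MvPolynomial.IsHomogeneous.prod _ _ _ fun k _ => ?_
  rw [smul_eq_mul, mul_comm]
  exact (hf k).pow _

theorem isHomogeneous_esymm {σ K : Type*} [CommRing K] [Fintype σ] (k : ℕ) :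
    (MvPolynomial.esymm σ K k).IsHomogeneous k := by
  refine MvPolynomial.IsHomogeneous.sum _ _ _ fun t ht => ?_
  have h := MvPolynomial.IsHomogeneous.prod t (fun i => (MvPolynomial.X i : MvPolynomial σ K))
    (fun _ => 1) fun i _ => MvPolynomial.isHomogeneous_X _ _
  rwa [Finset.sum_const, smul_eq_mul, mul_one, (Finset.mem_powersetCard.1 ht).2] at h

/-- Substitution of the elementary symmetric polynomials is injective and turns weight into degree.
So `Q` and its component of weight `d` have the same image `φ` and must coincide. The weight is `k +
1` because the variable with index `k : Fin N` stands for the elementary polynomial of degree `k +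
1`. -/
theorem isWeightedHomogeneous_esymmAlgEquiv_symm {N d : ℕ} (φ : MvPolynomial (Fin N) ℂ)
    (hφ : φ.IsSymmetric) (hdeg : φ.IsHomogeneous d) :
    MvPolynomial.IsWeightedHomogeneous (fun k : Fin N => (k : ℕ) + 1)
      ((MvPolynomial.esymmAlgEquiv (Fin N) ℂ (Fintype.card_fin N)).symm ⟨φ, hφ⟩) d := by
  classical
  set w : Fin N → ℕ := fun k => (k : ℕ) + 1
  set Q := (MvPolynomial.esymmAlgEquiv (Fin N) ℂ (Fintype.card_fin N)).symm ⟨φ, hφ⟩ with hQ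
  set f : Fin N → MvPolynomial (Fin N) ℂ := fun k => MvPolynomial.esymm (Fin N) ℂ (k + 1)
  have hval : ∀ q, ((MvPolynomial.esymmAlgEquiv (Fin N) ℂ (Fintype.card_fin N)) q :
      MvPolynomial (Fin N) ℂ) = MvPolynomial.aeval f q := fun q => by
    rw [MvPolynomial.esymmAlgEquiv_apply]
    exact MvPolynomial.esymmAlgHom_apply q
  have hinj : ∀ q, MvPolynomial.aeval f q = 0 → q = 0 := fun q hq => by
    rw [← hval] at hq
    exact (map_eq_zero_iff _ (AlgEquiv.injective _)).1 (Subtype.ext hq)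
  have hφQ : φ = MvPolynomial.aeval f Q := by rw [← hval, hQ, AlgEquiv.apply_symm_apply]
  set Q' := MvPolynomial.weightedHomogeneousComponent w d Q
  -- Taking components commutes with the substitution: each weighted component of `Q` has a
  -- homogeneous image, so only one of them contributes in degree `m`.
  have hcomp : ∀ m, MvPolynomial.homogeneousComponent m (MvPolynomial.aeval f Q)
      = MvPolynomial.aeval f (MvPolynomial.weightedHomogeneousComponent w m Q) := by
    intro m
    have hfin := MvPolynomial.weightedHomogeneousComponent_finsupp (w := w) Q
    have hsum : Q = ∑ i ∈ hfin.toFinset, MvPolynomial.weightedHomogeneousComponent w i Q := by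
      conv_lhs => rw [← MvPolynomial.sum_weightedHomogeneousComponent w Q]
      exact finsum_eq_sum _ hfin
    have hhom : ∀ i, (MvPolynomial.aeval f
        (MvPolynomial.weightedHomogeneousComponent w i Q)).IsHomogeneous i := fun i =>
      isHomogeneous_aeval_of_isWeightedHomogeneous w f
        (fun k => isHomogeneous_esymm _)
        (MvPolynomial.weightedHomogeneousComponent_isWeightedHomogeneous _ _)
    conv_lhs => rw [hsum, map_sum, map_sum]
    rw [Finset.sum_congr rfl fun i _ => MvPolynomial.homogeneousComponent_of_mem (hhom i)]
    rw [Finset.sum_ite_eq]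
    split_ifs with h
    · rfl
    · by_contra hne
      refine h ((Set.Finite.mem_toFinset hfin).2 fun h0 => hne ?_)
      change MvPolynomial.weightedHomogeneousComponent w m Q = 0 at h0
      rw [h0, map_zero]
  have h1 : MvPolynomial.aeval f (Q - Q') = 0 := by
    rw [map_sub, ← hcomp, ← hφQ, MvPolynomial.homogeneousComponent_of_mem hdeg, if_pos rfl,
      sub_self]
  rw [sub_eq_zero.1 (hinj _ h1)]
  exact MvPolynomial.weightedHomogeneousComponent_isWeightedHomogeneous _ _

/-! ### Ideals of even forms and restriction to a subspace -/

section Forms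

variable {T : Type*} [AddCommGroup T] [Module ℝ T]

theorem symmForm_mem_pow {ι : Type*} [Fintype ι] [DecidableEq ι]
    (Ω : Matrix ι ι (EvenForms T)) (J : Ideal (EvenForms T)) (hΩ : ∀ i j, Ω i j ∈ J)
    {N d : ℕ} (φ : MvPolynomial (Fin N) ℂ) (hφ : φ.IsSymmetric) (hdeg : φ.IsHomogeneous d) :
    symmForm Ω φ hφ ∈ J ^ d := by
  refine aeval_mem_pow_of_isWeightedHomogeneous J (fun k : Fin N => (k : ℕ) + 1) _ (fun k => ?_)
    (isWeightedHomogeneous_esymmAlgEquiv_symm φ hφ hdeg)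
  refine coeff_det_one_add_X_smul_mem J _ (fun i j => ?_) _
  rw [Matrix.smul_apply, Algebra.smul_def]
  exact J.mul_mem_left _ (hΩ i j)

theorem ι_mul_swap (f g : T →ₗ[ℝ] ℂ) : (ExteriorAlgebra.ι ℂ f * ExteriorAlgebra.ι ℂ g)
    = - (ExteriorAlgebra.ι ℂ g * ExteriorAlgebra.ι ℂ f) :=
  eq_neg_of_add_eq_zero_left (ExteriorAlgebra.ι_add_mul_swap f g)

theorem wedge_swap (f g : T →ₗ[ℝ] ℂ) : wedge f g = - wedge g f :=
  Subtype.ext (ι_mul_swap f g)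

theorem wedge_mul_wedge_self (f g h : T →ₗ[ℝ] ℂ) : wedge f g * wedge f h = 0 := by
  refine Subtype.ext ?_
  change ExteriorAlgebra.ι ℂ f * ExteriorAlgebra.ι ℂ g
    * (ExteriorAlgebra.ι ℂ f * ExteriorAlgebra.ι ℂ h) = 0
  rw [ι_mul_swap f g, neg_mul, mul_assoc, ← mul_assoc (ExteriorAlgebra.ι ℂ f),
    ExteriorAlgebra.ι_sq_zero, zero_mul, mul_zero, neg_zero]

/-- The wedge product as a bilinear map. -/
def wedgeₗ : (T →ₗ[ℝ] ℂ) →ₗ[ℂ] (T →ₗ[ℝ] ℂ) →ₗ[ℂ] EvenForms T :=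
  LinearMap.mk₂ ℂ wedge
    (fun f f' g => Subtype.ext (by simp [wedge, add_mul]))
    (fun c f g => Subtype.ext (by simp [wedge]))
    (fun f g g' => Subtype.ext (by simp [wedge, mul_add]))
    (fun c f g => Subtype.ext (by simp [wedge]))

theorem wedgeₗ_apply (f g : T →ₗ[ℝ] ℂ) : wedgeₗ f g = wedge f g := rfl

/-- The ideal of even forms generated by the products of the one-forms `θ a` with one-forms. -/
def wedgeIdeal {m : ℕ} (θ : Fin m → T →ₗ[ℝ] ℂ) : Ideal (EvenForms T) :=
  Ideal.span {w | ∃ a η, w = wedge (θ a) η}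

/-- A product of `d > m` generators uses some `θ a` twice, and two wedge products with a common
factor multiply to zero. The ring of even forms is commutative, so the two factors can be brought
together. -/
theorem wedgeIdeal_pow {m d : ℕ} (θ : Fin m → T →ₗ[ℝ] ℂ) (hd : m < d) :
    wedgeIdeal θ ^ d = ⊥ := by
  have hpow := Submodule.span_pow (R := EvenForms T) {w | ∃ a η, w = wedge (θ a) η} d
  change Ideal.span _ ^ d = Ideal.span _ at hpow
  rw [wedgeIdeal, hpow, Ideal.span_eq_bot]
  intro x hx
  obtain ⟨f, rfl⟩ := Set.mem_pow.1 hx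
  choose a η hη using fun i => (f i).2
  obtain ⟨i, j, hij, he⟩ := Fintype.exists_ne_map_eq_of_card_lt a (by simpa using hd)
  rw [List.prod_ofFn, ← Finset.mul_prod_erase _ _ (Finset.mem_univ i),
    ← Finset.mul_prod_erase _ _ (Finset.mem_erase.2 ⟨hij.symm, Finset.mem_univ j⟩), ← mul_assoc,
    hη i, hη j, he, wedge_mul_wedge_self, zero_mul]

/-- Restriction to a subspace, on one-forms. -/
def restrictOne (W : Submodule ℝ T) : (T →ₗ[ℝ] ℂ) →ₗ[ℂ] (W →ₗ[ℝ] ℂ) where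
  toFun f := f ∘ₗ W.subtype
  map_add' _ _ := rfl
  map_smul' _ _ := rfl

theorem restrictForm_mem (W : Submodule ℝ T) (w : EvenForms T) :
    restrictForm W (w : FormAlg T) ∈ EvenForms W := by
  obtain ⟨w, hw⟩ := w
  change restrictForm W w ∈ EvenForms W
  induction hw using Algebra.adjoin_induction with
  | mem x hx =>
    obtain ⟨f, g, rfl⟩ := hx
    rw [map_mul, restrictForm, ExteriorAlgebra.map_apply_ι, ExteriorAlgebra.map_apply_ι]
    exact Algebra.subset_adjoin ⟨_, _, rfl⟩
  | algebraMap r => rw [AlgHom.commutes]; exact Subalgebra.algebraMap_mem _ _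
  | add x y _ _ hx hy => rw [map_add]; exact Subalgebra.add_mem _ hx hy
  | mul x y _ _ hx hy => rw [map_mul]; exact Subalgebra.mul_mem _ hx hy

/-- Restriction to a subspace, on forms of even degree. -/
def restrictEven (W : Submodule ℝ T) : EvenForms T →ₐ[ℂ] EvenForms W :=
  ((restrictForm W).comp (EvenForms T).val).codRestrict _ (restrictForm_mem W)

theorem coe_restrictEven (W : Submodule ℝ T) (w : EvenForms T) :
    (restrictEven W w : FormAlg W) = restrictForm W (w : FormAlg T) := rfl

theorem restrictEven_wedge (W : Submodule ℝ T) (f g : T →ₗ[ℝ] ℂ) :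
    restrictEven W (wedge f g) = wedge (restrictOne W f) (restrictOne W g) := by
  refine Subtype.ext ?_
  rw [coe_restrictEven]
  change restrictForm W (ExteriorAlgebra.ι ℂ f * ExteriorAlgebra.ι ℂ g) = _
  rw [map_mul, restrictForm, ExteriorAlgebra.map_apply_ι, ExteriorAlgebra.map_apply_ι]
  rfl

/-- The one-forms `θ` live on `W` only, so the ideal used on `T` is the preimage of `wedgeIdeal θ`
under restriction. Powers of a preimage lie in the preimage of the power, which here is the kernel
of restriction. -/
theorem restrictForm_symmForm_eq_zero (W : Submodule ℝ T) {ι : Type*} [Fintype ι] [DecidableEq ι]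
    (Ω : Matrix ι ι (EvenForms T)) {m : ℕ} (θ : Fin m → W →ₗ[ℝ] ℂ)
    (hΩ : ∀ i j, restrictEven W (Ω i j) ∈ wedgeIdeal θ)
    {N d : ℕ} (φ : MvPolynomial (Fin N) ℂ) (hφ : φ.IsSymmetric) (hdeg : φ.IsHomogeneous d)
    (hd : m < d) : restrictForm W (symmForm Ω φ hφ : FormAlg T) = 0 := by
  have h := symmForm_mem_pow Ω ((wedgeIdeal θ).comap (restrictEven W)) hΩ φ hφ hdeg
  have h' := Ideal.le_comap_pow (restrictEven W) d h
  rw [wedgeIdeal_pow θ hd, Ideal.mem_comap, Ideal.mem_bot] at h'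
  rw [← coe_restrictEven, h']
  rfl

/-- A real coordinate function of a basis, as a complex-valued one-form. -/
def ccoord {ι : Type*} (v : Module.Basis ι ℝ T) (i : ι) : T →ₗ[ℝ] ℂ :=
  Complex.ofRealCLM.toLinearMap ∘ₗ v.coord i

theorem eq_sum_ccoord {ι : Type*} [Fintype ι] (v : Module.Basis ι ℝ T) (f : T →ₗ[ℝ] ℂ) :
    f = ∑ i, f (v i) • ccoord v i := by
  classical
  refine v.ext fun j => ?_
  have h : ∀ i, ccoord v i (v j) = if i = j then 1 else 0 := fun i => by
    simp only [ccoord, LinearMap.comp_apply, Module.Basis.coord_apply, v.repr_self,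
      Finsupp.single_apply, ContinuousLinearMap.coe_coe, Complex.ofRealCLM_apply, eq_comm (a := j)]
    split_ifs <;> simp
  simp [LinearMap.sum_apply, h]

/-- `twoForm` is built from a basis of `T` that need not be adapted to `W`. Expanding the restricted
dual basis in the coordinates of `v` shows that the restriction is given by the same formula in any
basis of `W`. -/
theorem restrictEven_twoForm [FiniteDimensional ℝ T] (W : Submodule ℝ T)
    (B : T →ₗ[ℝ] T →ₗ[ℝ] ℂ) {κ : Type*} [Fintype κ] (v : Module.Basis κ ℝ W) :
    restrictEven W (twoForm fun a b => B a b)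
      = (1 / 2 : ℂ) • ∑ k, ∑ l, B (v k) (v l) • wedge (ccoord v k) (ccoord v l) := by
  classical
  set e := Module.finBasis ℝ T
  have hr : ∀ i, restrictOne W (ccoord e i) = ∑ k, (ccoord e i) (v k) • ccoord v k := fun i =>
    eq_sum_ccoord v _
  have hB : ∀ k l, B (v k) (v l)
      = ∑ i, ∑ j, ccoord e i (v k) * ccoord e j (v l) * B (e i) (e j) := by
    intro k l
    conv_lhs => rw [← e.sum_repr (v k : T), ← e.sum_repr (v l : T)]
    simp only [map_sum, LinearMap.sum_apply, map_smul, LinearMap.smul_apply, ccoord,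
      LinearMap.comp_apply, Module.Basis.coord_apply, ContinuousLinearMap.coe_coe,
      Complex.ofRealCLM_apply, Complex.real_smul, Finset.mul_sum]
    rw [Finset.sum_comm]
    simp only [mul_assoc, mul_left_comm]
  have h1 : (twoForm fun a b => B a b) = (1 / 2 : ℂ) • ∑ i, ∑ j, B (e i) (e j) •
    wedge (ccoord e i) (ccoord e j) := rfl
  rw [h1, map_smul]
  congr 1
  simp only [map_sum, map_smul, restrictEven_wedge, hr]
  simp only [← wedgeₗ_apply, map_sum, LinearMap.sum_apply, map_smul, LinearMap.smul_apply,
    Finset.smul_sum, smul_smul, hB, Finset.sum_smul]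
  have swap : ∀ F : Fin (Module.finrank ℝ T) → Fin (Module.finrank ℝ T) → κ → κ → EvenForms W,
      ∑ i, ∑ j, ∑ k, ∑ l, F i j k l = ∑ k, ∑ l, ∑ i, ∑ j, F i j k l := fun F => by
    calc _ = ∑ i, ∑ k, ∑ j, ∑ l, F i j k l := by
            refine Finset.sum_congr rfl fun i _ => Finset.sum_comm
      _ = ∑ k, ∑ i, ∑ j, ∑ l, F i j k l := Finset.sum_comm
      _ = ∑ k, ∑ i, ∑ l, ∑ j, F i j k l :=
            Finset.sum_congr rfl fun k _ => Finset.sum_congr rfl fun i _ => Finset.sum_comm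
      _ = _ := Finset.sum_congr rfl fun k _ => Finset.sum_comm
  have swap' : ∀ F : Fin (Module.finrank ℝ T) → Fin (Module.finrank ℝ T) → κ → κ → EvenForms W,
      ∑ i, ∑ j, ∑ k, ∑ l, F i j l k = ∑ k, ∑ l, ∑ i, ∑ j, F i j k l := fun F => by
    rw [swap fun i j k l => F i j l k]; exact Finset.sum_comm
  rw [swap']
  refine Finset.sum_congr rfl fun k _ => Finset.sum_congr rfl fun l _ =>
    Finset.sum_congr rfl fun i _ => Finset.sum_congr rfl fun j _ => ?_
  congr 1; ring

/-- The complex bilinear extension of a real bilinear map. -/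
def complexify₂ {A : Type*} [AddCommGroup A] [Module ℂ A] (B : T →ₗ[ℝ] T →ₗ[ℝ] A) :
    (ℂ ⊗[ℝ] T) →ₗ[ℂ] (ℂ ⊗[ℝ] T) →ₗ[ℂ] A :=
  LinearMap.liftBaseChange ℂ
    ((LinearMap.liftBaseChangeEquiv ℂ).toLinearMap.restrictScalars ℝ ∘ₗ B)

theorem complexify₂_tmul {A : Type*} [AddCommGroup A] [Module ℂ A] (B : T →ₗ[ℝ] T →ₗ[ℝ] A)
    (c d : ℂ) (u v : T) : complexify₂ B (c ⊗ₜ u) (d ⊗ₜ v) = (c * d) • B u v := by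
  simp [complexify₂, mul_smul]

/-- A two-form whose complexification vanishes on the span of the vectors `g j` restricts to an
element of the ideal generated by the one-forms `θ a`, if on the subspace these are the
coordinates complementary to the `g j`. -/
theorem restrictEven_twoForm_mem [FiniteDimensional ℝ T] (W : Submodule ℝ T)
    (B : T →ₗ[ℝ] T →ₗ[ℝ] ℂ) {m : ℕ} {J : Type*} [Fintype J]
    (e : Fin m → ℂ ⊗[ℝ] T) (g : J → ℂ ⊗[ℝ] T) (θ : Fin m → W →ₗ[ℝ] ℂ) (ξ : J → W →ₗ[ℝ] ℂ)
    (h : ∀ u : W, (1 : ℂ) ⊗ₜ[ℝ] (u : T) = ∑ a, θ a u • e a + ∑ j, ξ j u • g j)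
    (hg : ∀ i j, complexify₂ B (g i) (g j) = 0) :
    restrictEven W (twoForm fun a b => B a b) ∈ wedgeIdeal θ := by
  classical
  set v := Module.finBasis ℝ W
  set C := complexify₂ B
  -- Inserting the decomposition `h` in the first argument of `C` gives `∑ θ a ⊗ C (e a)` plus terms
  -- `ξ j ⊗ C (g j)`. In these, inserting it in the second argument leaves only `C (g j) (e a) θ a`,
  -- because `C` vanishes on the `g j`. So `P a` is the cofactor of `θ a` on the right and `Q a` the
  -- one on the left.
  set P : Fin m → W →ₗ[ℝ] ℂ := fun a =>
    (C (e a)).restrictScalars ℝ ∘ₗ TensorProduct.mk ℝ ℂ T 1 ∘ₗ W.subtype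
  set Q : Fin m → W →ₗ[ℝ] ℂ := fun a => ∑ j, C (g j) (e a) • ξ j
  have hB : ∀ k l, B (v k) (v l)
      = ∑ a, (θ a (v k) * P a (v l) + Q a (v k) * θ a (v l)) := by
    intro k l
    have h1 : B (v k) (v l) = C ((1 : ℂ) ⊗ₜ (v k : T)) ((1 : ℂ) ⊗ₜ (v l : T)) := by
      rw [complexify₂_tmul]; simp
    have h2 : ∀ j, C (g j) ((1 : ℂ) ⊗ₜ (v l : T)) = ∑ a, θ a (v l) * C (g j) (e a) := by
      intro j
      rw [h]
      simp [hg, C]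
    have h3 : ∀ a, P a (v l) = C (e a) ((1 : ℂ) ⊗ₜ (v l : T)) := fun a => rfl
    rw [h1, h (v k)]
    simp only [map_add, LinearMap.add_apply, map_sum, LinearMap.sum_apply, map_smul,
      LinearMap.smul_apply, smul_eq_mul, h2, h3, Finset.sum_add_distrib, Q, Finset.sum_mul,
      Finset.mul_sum]
    congr 1
    rw [Finset.sum_comm]
    refine Finset.sum_congr rfl fun _ _ => Finset.sum_congr rfl fun _ _ => ?_
    ring
  -- The coordinate expression of `f ⊗ f'` antisymmetrizes to `f ∧ f'`; this converts the formula
  -- `hB` for values into one for forms.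
  have hw : ∀ f f' : W →ₗ[ℝ] ℂ, ∑ k, ∑ l, (f (v k) * f' (v l)) • wedge (ccoord v k) (ccoord v l)
      = wedge f f' := by
    intro f f'
    conv_rhs => rw [eq_sum_ccoord v f, eq_sum_ccoord v f', ← wedgeₗ_apply]
    simp only [← wedgeₗ_apply, map_sum, LinearMap.sum_apply, map_smul, LinearMap.smul_apply,
      Finset.smul_sum, smul_smul]
    rw [Finset.sum_comm]
    refine Finset.sum_congr rfl fun _ _ => Finset.sum_congr rfl fun _ _ => ?_
    rw [mul_comm]
  have key : restrictEven W (twoForm fun a b => B a b)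
      = (1 / 2 : ℂ) • ∑ a, (wedge (θ a) (P a) + wedge (Q a) (θ a)) := by
    rw [restrictEven_twoForm W B v]
    congr 1
    have h4 : ∀ a, wedge (θ a) (P a) + wedge (Q a) (θ a)
        = ∑ k, ∑ l, (θ a (v k) * P a (v l) + Q a (v k) * θ a (v l)) •
          wedge (ccoord v k) (ccoord v l) := fun a => by
      rw [← hw (θ a), ← hw (Q a)]
      simp only [← Finset.sum_add_distrib, ← add_smul]
    refine Eq.trans ?_ (Finset.sum_congr rfl fun a _ => (h4 a).symm)
    symm
    rw [Finset.sum_comm]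
    refine Finset.sum_congr rfl fun k _ => ?_
    rw [Finset.sum_comm]
    refine Finset.sum_congr rfl fun l _ => ?_
    rw [hB, Finset.sum_smul]
  rw [key, Algebra.smul_def]
  refine Ideal.mul_mem_left _ _ (Ideal.sum_mem _ fun a _ => Ideal.add_mem _ ?_ ?_)
  · exact Ideal.subset_span ⟨a, _, rfl⟩
  · rw [wedge_swap]
    exact neg_mem (Ideal.subset_span ⟨a, _, rfl⟩)

end Forms

/-! ### Coordinate vector fields -/

theorem two_le_infty : (2 : WithTop ℕ∞) ≤ ∞ := by
  exact WithTop.coe_le_coe.2 (le_top : (2 : ℕ∞) ≤ ⊤)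

section CoordField

variable {n s : ℕ} {M : Type*} [TopologicalSpace M] [ChartedSpace (Model n s) M]

/-- The vector field with constant components `v` in the chart `φ`. -/
def coordField (φ : OpenPartialHomeomorph M (Model n s)) (v : Model n s) (x : M) :
    TangentSpace (MI n s) x :=
  (mfderiv (MI n s) 𝓘(ℝ, Model n s) φ x).inverse v

/-- As a pullback of a constant field, a coordinate field inherits smoothness and the naturality of
the Lie bracket. -/
theorem coordField_eq_mpullback (φ : OpenPartialHomeomorph M (Model n s)) (v : Model n s) :
    coordField φ v = VectorField.mpullback (MI n s) 𝓘(ℝ, Model n s) φ (fun _ => v) := rfl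

variable [IsManifold (MI n s) ∞ M] {φ : OpenPartialHomeomorph M (Model n s)}

theorem mdifferentiable_of_mem_maximalAtlas (hφ : φ ∈ IsManifold.maximalAtlas (MI n s) ∞ M) :
    φ.MDifferentiable (MI n s) (MI n s) :=
  ⟨(contMDiffOn_of_mem_maximalAtlas hφ).mdifferentiableOn (by simp),
    (contMDiffOn_symm_of_mem_maximalAtlas hφ).mdifferentiableOn (by simp)⟩

theorem isInvertible_mfderiv (hφ : φ ∈ IsManifold.maximalAtlas (MI n s) ∞ M) {x : M}
    (hx : x ∈ φ.source) : (mfderiv (MI n s) 𝓘(ℝ, Model n s) φ x).IsInvertible :=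
  ⟨(mdifferentiable_of_mem_maximalAtlas hφ).mfderiv hx, rfl⟩

theorem mfderiv_coordField (hφ : φ ∈ IsManifold.maximalAtlas (MI n s) ∞ M) {x : M}
    (hx : x ∈ φ.source) (v : Model n s) :
    mfderiv (MI n s) 𝓘(ℝ, Model n s) φ x (coordField φ v x) = v :=
  (isInvertible_mfderiv hφ hx).self_apply_inverse v

theorem coordField_mfderiv (hφ : φ ∈ IsManifold.maximalAtlas (MI n s) ∞ M) {x : M}
    (hx : x ∈ φ.source) (u : TangentSpace (MI n s) x) :
    coordField φ (mfderiv (MI n s) 𝓘(ℝ, Model n s) φ x u) x = u :=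
  (isInvertible_mfderiv hφ hx).inverse_apply_self u

theorem contMDiffAt_coordField (hφ : φ ∈ IsManifold.maximalAtlas (MI n s) ∞ M) {x : M}
    (hx : x ∈ φ.source) (v : Model n s) :
    ContMDiffAt (MI n s) (MI n s).tangent ∞
      (fun y => (⟨y, coordField φ v y⟩ : TangentBundle (MI n s) M)) x := by
  rw [coordField_eq_mpullback]
  have hv : ContMDiffAt 𝓘(ℝ, Model n s) 𝓘(ℝ, Model n s).tangent ∞
      (fun y : Model n s => (⟨y, v⟩ : TangentBundle 𝓘(ℝ, Model n s) (Model n s))) (φ x) :=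
    contMDiffAt_vectorSpace_iff_contDiffAt.2 contDiffAt_const
  exact hv.mpullback_vectorField_preimage (contMDiffAt_of_mem_maximalAtlas hφ hx)
    (isInvertible_mfderiv hφ hx) (by simp)

theorem mdifferentiableAt_coordField (hφ : φ ∈ IsManifold.maximalAtlas (MI n s) ∞ M) {x : M}
    (hx : x ∈ φ.source) (v : Model n s) :
    MDifferentiableAt (MI n s) (MI n s).tangent
      (fun y => (⟨y, coordField φ v y⟩ : TangentBundle (MI n s) M)) x :=
  (contMDiffAt_coordField hφ hx v).mdifferentiableAt (by simp)

/-- The bracket commutes with pullback, and constant fields on a vector space commute. -/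
theorem mlieBracket_coordField (hφ : φ ∈ IsManifold.maximalAtlas (MI n s) ∞ M) {x : M}
    (hx : x ∈ φ.source) (v w : Model n s) :
    VectorField.mlieBracket (MI n s) (coordField φ v) (coordField φ w) x = 0 := by
  have : IsManifold (MI n s) (minSmoothness ℝ 2) M := by
    rw [minSmoothness_of_isRCLikeNormedField]
    exact IsManifold.of_le (n := ∞) two_le_infty
  set c : Model n s → (Π z : Model n s, TangentSpace 𝓘(ℝ, Model n s) z) := fun v _ => v
  have hc : ∀ v z, MDifferentiableAt 𝓘(ℝ, Model n s) 𝓘(ℝ, Model n s).tangent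
      (fun y : Model n s => (⟨y, c v y⟩ : TangentBundle 𝓘(ℝ, Model n s) (Model n s))) z :=
    fun v z => (contMDiffAt_vectorSpace_iff_contDiffAt (n := 1).2
      contDiffAt_const).mdifferentiableAt (by simp)
  have h := VectorField.mpullback_mlieBracket (n := ∞) (hc v (φ x)) (hc w (φ x))
    (contMDiffAt_of_mem_maximalAtlas hφ hx)
    (by rw [minSmoothness_of_isRCLikeNormedField]; exact two_le_infty)
  refine h.symm.trans ?_
  rw [VectorField.mpullback_apply, ← VectorField.mlieBracketWithin_univ,
    VectorField.mlieBracketWithin_eq_lieBracketWithin, VectorField.lieBracketWithin_univ]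
  have h0 : VectorField.lieBracket ℝ (c v) (c w) (φ x) = 0 := by
    simp [VectorField.lieBracket, c]
  rw [h0]
  exact map_zero _

/-! ### Derivatives of functions along coordinate fields -/

variable {G : Type*} [NormedAddCommGroup G] [NormedSpace ℝ G]

theorem mvfderiv_coordField (hφ : φ ∈ IsManifold.maximalAtlas (MI n s) ∞ M) {x : M}
    (hx : x ∈ φ.source) (v : Model n s) {f : M → G} (hf : MDifferentiableAt (MI n s) 𝓘(ℝ, G) f x) :
    mvfderiv (MI n s) f x (coordField φ v x) = fderiv ℝ (f ∘ φ.symm) (φ x) v := by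
  have hD := mdifferentiable_of_mem_maximalAtlas hφ
  have h1 : f =ᶠ[𝓝 x] (f ∘ φ.symm) ∘ φ := by
    filter_upwards [φ.open_source.mem_nhds hx] with y hy
    simp [hy]
  have h2 : MDifferentiableAt 𝓘(ℝ, Model n s) 𝓘(ℝ, G) (f ∘ φ.symm) (φ x) := by
    refine MDifferentiableAt.comp (I' := MI n s) _ ?_
      (hD.mdifferentiableAt_symm (φ.map_source hx))
    rwa [φ.left_inv hx]
  have h3 : mfderiv (MI n s) 𝓘(ℝ, G) f x
      = (mfderiv 𝓘(ℝ, Model n s) 𝓘(ℝ, G) (f ∘ φ.symm) (φ x)).comp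
        (mfderiv (MI n s) 𝓘(ℝ, Model n s) φ x) := by
    rw [h1.mfderiv_eq]
    exact mfderiv_comp x h2 (hD.mdifferentiableAt hx)
  refine (DFunLike.congr_fun h3 (coordField φ v x)).trans ?_
  change mfderiv 𝓘(ℝ, Model n s) 𝓘(ℝ, G) (f ∘ φ.symm) (φ x)
    (mfderiv (MI n s) 𝓘(ℝ, Model n s) φ x (coordField φ v x)) = _
  rw [mfderiv_coordField hφ hx, mfderiv_eq_fderiv]
  rfl

theorem contDiffAt_comp_symm (hφ : φ ∈ IsManifold.maximalAtlas (MI n s) ∞ M) {x : M}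
    (hx : x ∈ φ.source) {f : M → G} (hf : ContMDiffAt (MI n s) 𝓘(ℝ, G) ∞ f x) :
    ContDiffAt ℝ ∞ (f ∘ φ.symm) (φ x) := by
  rw [← contMDiffAt_iff_contDiffAt]
  refine ContMDiffAt.comp (I' := MI n s) _ ?_
    (contMDiffAt_symm_of_mem_maximalAtlas hφ (φ.map_source hx))
  rwa [φ.left_inv hx]

/-- The derivative of a smooth function along a coordinate field, in coordinates. -/
theorem eventually_mvfderiv_coordField (hφ : φ ∈ IsManifold.maximalAtlas (MI n s) ∞ M) {U : Set M}
    (hU : IsOpen U) {x : M} (hxU : x ∈ U) (hx : x ∈ φ.source) (v : Model n s) {f : M → G}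
    (hf : ContMDiffOn (MI n s) 𝓘(ℝ, G) ∞ f U) :
    (fun y => mvfderiv (MI n s) f y (coordField φ v y))
      =ᶠ[𝓝 x] (fun z => fderiv ℝ (f ∘ φ.symm) z v) ∘ φ := by
  filter_upwards [φ.open_source.mem_nhds hx, hU.mem_nhds hxU] with y hy hyU
  exact mvfderiv_coordField hφ hy v
    ((hf.contMDiffAt (hU.mem_nhds hyU)).mdifferentiableAt (by simp))

theorem contMDiffAt_mvfderiv_coordField (hφ : φ ∈ IsManifold.maximalAtlas (MI n s) ∞ M)
    {U : Set M} (hU : IsOpen U) {x : M} (hxU : x ∈ U) (hx : x ∈ φ.source) (v : Model n s)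
    {f : M → G} (hf : ContMDiffOn (MI n s) 𝓘(ℝ, G) ∞ f U) :
    ContMDiffAt (MI n s) 𝓘(ℝ, G) ∞ (fun y => mvfderiv (MI n s) f y (coordField φ v y)) x := by
  refine ContMDiffAt.congr_of_eventuallyEq ?_ (eventually_mvfderiv_coordField hφ hU hxU hx v hf)
  refine ContMDiffAt.comp (I' := 𝓘(ℝ, Model n s)) _ ?_ (contMDiffAt_of_mem_maximalAtlas hφ hx)
  rw [contMDiffAt_iff_contDiffAt]
  exact ((contDiffAt_comp_symm hφ hx (hf.contMDiffAt (hU.mem_nhds hxU))).fderiv_right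
    (by simp)).clm_apply contDiffAt_const

/-- Derivatives along coordinate fields commute. -/
theorem mvfderiv_coordField_comm (hφ : φ ∈ IsManifold.maximalAtlas (MI n s) ∞ M) {U : Set M}
    (hU : IsOpen U) {x : M} (hxU : x ∈ U) (hx : x ∈ φ.source) (v w : Model n s) {f : M → G}
    (hf : ContMDiffOn (MI n s) 𝓘(ℝ, G) ∞ f U) :
    mvfderiv (MI n s) (fun y => mvfderiv (MI n s) f y (coordField φ w y)) x (coordField φ v x)
      = mvfderiv (MI n s) (fun y => mvfderiv (MI n s) f y (coordField φ v y)) x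
          (coordField φ w x) := by
  set h := f ∘ φ.symm
  have hh : ContDiffAt ℝ ∞ h (φ x) := contDiffAt_comp_symm hφ hx (hf.contMDiffAt (hU.mem_nhds hxU))
  have key : ∀ v w : Model n s,
      mvfderiv (MI n s) (fun y => mvfderiv (MI n s) f y (coordField φ w y)) x (coordField φ v x)
        = fderiv ℝ (fderiv ℝ h) (φ x) v w := by
    intro v w
    rw [mvfderiv_coordField hφ hx v
      ((contMDiffAt_mvfderiv_coordField hφ hU hxU hx w hf).mdifferentiableAt (by simp))]
    have hev : ((fun y => mvfderiv (MI n s) f y (coordField φ w y)) ∘ φ.symm)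
        =ᶠ[𝓝 (φ x)] fun z => fderiv ℝ h z w := by
      have hc := (φ.continuousAt_symm (φ.map_source hx))
      have := hc.eventually (by
        rw [φ.left_inv hx]; exact eventually_mvfderiv_coordField hφ hU hxU hx w hf)
      filter_upwards [this, φ.open_target.mem_nhds (φ.map_source hx)] with z hz hzt
      simp only [Function.comp_apply] at hz ⊢
      rw [hz, φ.right_inv hzt]
    rw [hev.fderiv_eq, fderiv_clm_apply _ (differentiableAt_const w)]
    · simp
    · exact (hh.fderiv_right (m := ∞) (by simp)).differentiableAt (by simp)
  rw [key, key]
  refine (hh.isSymmSndFDerivAt ?_).eq v w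
  rw [minSmoothness_of_isRCLikeNormedField]
  exact two_le_infty

end CoordField

/-! ### Tensoriality of the curvature -/

section Curvature

variable {n s : ℕ} {M : Type*} [TopologicalSpace M] [ChartedSpace (Model n s) M]
  [IsManifold (MI n s) ∞ M]
  {F : Type*} [NormedAddCommGroup F] [NormedSpace ℂ F]
  {E : M → Type*} [TopologicalSpace (TotalSpace F E)] [∀ x, AddCommGroup (E x)]
  [∀ x, Module ℂ (E x)] [∀ x, TopologicalSpace (E x)] [FiberBundle F E]
  [∀ x, IsTopologicalAddGroup (E x)] [∀ x, ContinuousSMul ℝ (E x)] [VectorBundle ℝ F E]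

/-- Differentiability at a point of a section of `E`. -/
abbrev DiffSec (F : Type*) [NormedAddCommGroup F] [NormedSpace ℂ F]
    {E : M → Type*} [TopologicalSpace (TotalSpace F E)] [∀ x, AddCommGroup (E x)]
    [∀ x, Module ℂ (E x)] [∀ x, TopologicalSpace (E x)] [FiberBundle F E]
    (σ : Π x : M, E x) (x : M) : Prop :=
  MDifferentiableAt (MI n s) ((MI n s).prod 𝓘(ℝ, F)) (fun y => TotalSpace.mk' F y (σ y)) x

/-- Differentiability at a point of a vector field. -/
abbrev DiffField (X : Π x : M, TangentSpace (MI n s) x) (x : M) : Prop :=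
  MDifferentiableAt (MI n s) (MI n s).tangent
    (fun y => (⟨y, X y⟩ : TangentBundle (MI n s) M)) x

variable (nabla : Connection n s F E)

namespace Connection

theorem toFun_add {σ τ : Π x : M, E x} {x : M} (hσ : DiffSec (n := n) (s := s) F σ x)
    (hτ : DiffSec (n := n) (s := s) F τ x) :
    nabla.toFun (fun y => σ y + τ y) x = nabla.toFun σ x + nabla.toFun τ x :=
  nabla.isCovariantDerivativeOnUniv.add hσ hτ

theorem toFun_smul {σ : Π x : M, E x} {f : M → ℝ} {x : M} (hσ : DiffSec (n := n) (s := s) F σ x)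
    (hf : MDifferentiableAt (MI n s) 𝓘(ℝ, ℝ) f x) (u : TangentSpace (MI n s) x) :
    nabla.toFun (fun y => f y • σ y) x u
      = f x • nabla.toFun σ x u + mvfderiv (MI n s) f x u • σ x := by
  have h := nabla.isCovariantDerivativeOnUniv.leibniz hσ hf
  exact DFunLike.congr_fun h u

theorem toFun_congr {σ τ : Π x : M, E x} {x : M} (hσ : DiffSec (n := n) (s := s) F σ x)
    (hτ : DiffSec (n := n) (s := s) F τ x) (h : ∀ᶠ y in 𝓝 x, σ y = τ y) :
    nabla.toFun σ x = nabla.toFun τ x :=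
  nabla.isCovariantDerivativeOnUniv.congr_of_eventuallyEq hσ hτ Filter.univ_mem h

theorem diffSec_toFun {σ : Π x : M, E x} {U : Set M} (hU : IsOpen U)
    (hσ : SmoothSecOn F E (n := n) (s := s) U σ) {x : M} (hx : x ∈ U)
    {X : Π x : M, TangentSpace (MI n s) x} (hX : DiffField X x) :
    DiffSec (n := n) (s := s) F (fun y => nabla.toFun σ y (X y)) x := by
  have h := (nabla.smooth U hU).contMDiff (σ := σ) hσ
  exact ((h.contMDiffAt (hU.mem_nhds hx)).mdifferentiableAt (by simp)).clm_bundle_apply hX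

/-- The curvature operator on real vector fields. -/
def curv (σ : Π x : M, E x) (x : M) (X Y : Π y : M, TangentSpace (MI n s) y) : E x :=
  nabla.toFun (fun y => nabla.toFun σ y (Y y)) x (X x)
    - nabla.toFun (fun y => nabla.toFun σ y (X y)) x (Y x)
    - nabla.toFun σ x (VectorField.mlieBracket (MI n s) X Y x)

theorem curv_swap (σ : Π x : M, E x) (x : M) (X Y : Π y : M, TangentSpace (MI n s) y) :
    nabla.curv σ x X Y = - nabla.curv σ x Y X := by
  rw [curv, curv, VectorField.mlieBracket_swap_apply, map_neg]
  abel

/-- The term `(Y f) ∇_X σ` appears twice with opposite signs: from the Leibniz rule for `∇_Y (f ∇_X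
σ)`, and from `[f X, Y] = f [X, Y] - (Y f) X`. -/
theorem tensorialAt_curv_left {σ : Π x : M, E x} {U : Set M} (hU : IsOpen U)
    (hσ : SmoothSecOn F E (n := n) (s := s) U σ) {x : M} (hx : x ∈ U)
    (Y : Π x : M, TangentSpace (MI n s) x) :
    TensorialAt (MI n s) (Model n s) (nabla.curv σ x · Y) x where
  smul {f X} hf hX := by
    have h1 : nabla.toFun (fun y => nabla.toFun σ y ((f • X) y)) x (Y x)
        = f x • nabla.toFun (fun y => nabla.toFun σ y (X y)) x (Y x)
          + mvfderiv (MI n s) f x (Y x) • nabla.toFun σ x (X x) := by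
      rw [← nabla.toFun_smul (nabla.diffSec_toFun hU hσ hx hX) hf]
      simp only [Pi.smul_apply', map_smul]
    simp only [curv]
    rw [h1, VectorField.mlieBracket_smul_left hf hX]
    simp only [Pi.smul_apply', map_smul, map_add, smul_sub]
    rw [neg_smul]
    abel
  add {X X'} hX hX' := by
    have h1 : nabla.toFun (fun y => nabla.toFun σ y ((X + X') y)) x (Y x)
        = nabla.toFun (fun y => nabla.toFun σ y (X y)) x (Y x)
          + nabla.toFun (fun y => nabla.toFun σ y (X' y)) x (Y x) := by
      rw [← add_apply,
        ← nabla.toFun_add (nabla.diffSec_toFun hU hσ hx hX) (nabla.diffSec_toFun hU hσ hx hX')]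
      simp only [Pi.add_apply, map_add]
    simp only [curv]
    rw [h1, VectorField.mlieBracket_add_left hX hX', map_add, Pi.add_apply, map_add]
    abel

theorem tensorialAt_curv_right {σ : Π x : M, E x} {U : Set M} (hU : IsOpen U)
    (hσ : SmoothSecOn F E (n := n) (s := s) U σ) {x : M} (hx : x ∈ U)
    (X : Π x : M, TangentSpace (MI n s) x) :
    TensorialAt (MI n s) (Model n s) (nabla.curv σ x X) x where
  smul {f Y} hf hY := by
    rw [curv_swap, (nabla.tensorialAt_curv_left hU hσ hx X).smul hf hY, nabla.curv_swap σ x X Y,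
      smul_neg]
  add {Y Y'} hY hY' := by
    rw [curv_swap, (nabla.tensorialAt_curv_left hU hσ hx X).add hY hY', nabla.curv_swap σ x X Y,
      nabla.curv_swap σ x X Y', neg_add]

/-- The curvature at a point, for a section that is smooth near the point. -/
def curvHom {σ : Π x : M, E x} {U : Set M} (hU : IsOpen U)
    (hσ : SmoothSecOn F E (n := n) (s := s) U σ) {x : M} (hx : x ∈ U) :
    TangentSpace (MI n s) x →L[ℝ] TangentSpace (MI n s) x →L[ℝ] E x :=
  TensorialAt.mkHom₂ (nabla.curv σ x) x
    (fun Y _ => nabla.tensorialAt_curv_left hU hσ hx Y)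
    (fun X _ => nabla.tensorialAt_curv_right hU hσ hx X)

theorem curvHom_apply {σ : Π x : M, E x} {U : Set M} (hU : IsOpen U)
    (hσ : SmoothSecOn F E (n := n) (s := s) U σ) {x : M} (hx : x ∈ U)
    {X Y : Π x : M, TangentSpace (MI n s) x} (hX : DiffField X x) (hY : DiffField Y x) :
    nabla.curvHom hU hσ hx (X x) (Y x) = nabla.curv σ x X Y :=
  TensorialAt.mkHom₂_apply _ _ hX hY

theorem curv_congr {σ τ : Π x : M, E x} {U : Set M} (hU : IsOpen U)
    (hσ : SmoothSecOn F E (n := n) (s := s) U σ) (hτ : SmoothSecOn F E (n := n) (s := s) U τ)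
    (h : ∀ y ∈ U, σ y = τ y) {x : M} (hx : x ∈ U)
    {X Y : Π x : M, TangentSpace (MI n s) x} (hX : DiffField X x) (hY : DiffField Y x) :
    nabla.curv σ x X Y = nabla.curv τ x X Y := by
  have h1 : ∀ y ∈ U, nabla.toFun σ y = nabla.toFun τ y := fun y hy =>
    nabla.toFun_congr ((hσ.contMDiffAt (hU.mem_nhds hy)).mdifferentiableAt (by simp))
      ((hτ.contMDiffAt (hU.mem_nhds hy)).mdifferentiableAt (by simp))
      (Filter.mem_of_superset (hU.mem_nhds hy) h)
  have h2 : ∀ {X : Π x : M, TangentSpace (MI n s) x}, DiffField X x →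
      nabla.toFun (fun y => nabla.toFun σ y (X y)) x
        = nabla.toFun (fun y => nabla.toFun τ y (X y)) x := fun {X} hX =>
    nabla.toFun_congr (nabla.diffSec_toFun hU hσ hx hX) (nabla.diffSec_toFun hU hτ hx hX)
      (Filter.mem_of_superset (hU.mem_nhds hx) fun y hy => by
        change nabla.toFun σ y (X y) = nabla.toFun τ y (X y)
        rw [h1 y hy])
  rw [curv, curv, h2 hX, h2 hY, h1 x hx]

theorem curv_add {σ τ : Π x : M, E x} {U : Set M} (hU : IsOpen U)
    (hσ : SmoothSecOn F E (n := n) (s := s) U σ) (hτ : SmoothSecOn F E (n := n) (s := s) U τ)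
    {x : M} (hx : x ∈ U)
    {X Y : Π x : M, TangentSpace (MI n s) x} (hX : DiffField X x) (hY : DiffField Y x) :
    nabla.curv (fun y => σ y + τ y) x X Y = nabla.curv σ x X Y + nabla.curv τ x X Y := by
  have hστ : SmoothSecOn F E (n := n) (s := s) U (fun y => σ y + τ y) := hσ.add_section hτ
  have h1 : ∀ y ∈ U, nabla.toFun (fun y => σ y + τ y) y = nabla.toFun σ y + nabla.toFun τ y :=
    fun y hy =>
      nabla.toFun_add ((hσ.contMDiffAt (hU.mem_nhds hy)).mdifferentiableAt (by simp))
        ((hτ.contMDiffAt (hU.mem_nhds hy)).mdifferentiableAt (by simp))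
  have h2 : ∀ {X : Π x : M, TangentSpace (MI n s) x}, DiffField X x →
      nabla.toFun (fun y => nabla.toFun (fun y => σ y + τ y) y (X y)) x
        = nabla.toFun (fun y => nabla.toFun σ y (X y)) x
          + nabla.toFun (fun y => nabla.toFun τ y (X y)) x := fun {X} hX => by
    have hσX := nabla.diffSec_toFun hU hσ hx hX
    have hτX := nabla.diffSec_toFun hU hτ hx hX
    rw [← nabla.toFun_add hσX hτX]
    refine nabla.toFun_congr (nabla.diffSec_toFun hU hστ hx hX)
      (mdifferentiableAt_add_section hσX hτX) ?_
    filter_upwards [hU.mem_nhds hx] with y hy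
    rw [h1 y hy, add_apply]
  rw [curv, curv, curv, h2 hX, h2 hY, h1 x hx]
  simp only [add_apply]
  abel

/-- Linearity over functions in the section is needed only for coordinate fields, since tensoriality
in the fields covers the rest. For these the bracket term disappears, and the second derivatives of
`f` cancel by symmetry. -/
theorem curv_smul {σ : Π x : M, E x} {f : M → ℝ} {U : Set M} (hU : IsOpen U)
    (hσ : SmoothSecOn F E (n := n) (s := s) U σ) (hf : ContMDiffOn (MI n s) 𝓘(ℝ, ℝ) ∞ f U)
    {x : M} (hx : x ∈ U) {φ : OpenPartialHomeomorph M (Model n s)}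
    (hφ : φ ∈ IsManifold.maximalAtlas (MI n s) ∞ M) (hxφ : x ∈ φ.source) (v w : Model n s) :
    nabla.curv (fun y => f y • σ y) x (coordField φ v) (coordField φ w)
      = f x • nabla.curv σ x (coordField φ v) (coordField φ w) := by
  have hfσ : SmoothSecOn F E (n := n) (s := s) U (fun y => f y • σ y) := hf.smul_section hσ
  have hσ1 : ∀ y ∈ U, DiffSec (n := n) (s := s) F σ y := fun y hy =>
    (hσ.contMDiffAt (hU.mem_nhds hy)).mdifferentiableAt (by simp)
  have hf1 : ∀ y ∈ U, MDifferentiableAt (MI n s) 𝓘(ℝ, ℝ) f y := fun y hy =>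
    (hf.contMDiffAt (hU.mem_nhds hy)).mdifferentiableAt (by simp)
  have hcf := fun v => mdifferentiableAt_coordField hφ hxφ v
  -- Two applications of the Leibniz rule. The two first-order cross terms are exchanged by swapping
  -- `v` and `w`, so they cancel in the commutator.
  have h2 : ∀ v w : Model n s,
      nabla.toFun (fun y => nabla.toFun (fun y => f y • σ y) y (coordField φ w y)) x
          (coordField φ v x)
        = f x • nabla.toFun (fun y => nabla.toFun σ y (coordField φ w y)) x (coordField φ v x)
          + mvfderiv (MI n s) f x (coordField φ v x) • nabla.toFun σ x (coordField φ w x)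
          + (mvfderiv (MI n s) f x (coordField φ w x) • nabla.toFun σ x (coordField φ v x)
            + mvfderiv (MI n s) (fun y => mvfderiv (MI n s) f y (coordField φ w y)) x
                (coordField φ v x) • σ x) := by
    intro v w
    have hσw := nabla.diffSec_toFun hU hσ hx (hcf w)
    have hfw : MDifferentiableAt (MI n s) 𝓘(ℝ, ℝ)
        (fun y => mvfderiv (MI n s) f y (coordField φ w y)) x :=
      (contMDiffAt_mvfderiv_coordField hφ hU hx hxφ w hf).mdifferentiableAt (by simp)
    have h3 : DiffSec (n := n) (s := s) F
        (fun y => f y • nabla.toFun σ y (coordField φ w y)) x := (hf1 x hx).smul_section hσw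
    have h4 : DiffSec (n := n) (s := s) F
        (fun y => mvfderiv (MI n s) f y (coordField φ w y) • σ y) x :=
      hfw.smul_section (hσ1 x hx)
    rw [← nabla.toFun_smul hσw (hf1 x hx), ← nabla.toFun_smul (hσ1 x hx) hfw, ← add_apply,
      ← nabla.toFun_add h3 h4]
    refine DFunLike.congr_fun (nabla.toFun_congr (nabla.diffSec_toFun hU hfσ hx (hcf w))
      (mdifferentiableAt_add_section h3 h4) ?_) _
    filter_upwards [hU.mem_nhds hx] with y hy
    exact nabla.toFun_smul (hσ1 y hy) (hf1 y hy) _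
  rw [curv, curv, h2, h2, mlieBracket_coordField hφ hxφ, map_zero, map_zero,
    mvfderiv_coordField_comm hφ hU hx hxφ v w hf]
  simp only [smul_sub, sub_zero]
  abel

theorem curv_sum_smul {κ : Type*} (A : Finset κ) {σ : κ → Π x : M, E x} {f : κ → M → ℝ}
    {U : Set M} (hU : IsOpen U) (hσ : ∀ i, SmoothSecOn F E (n := n) (s := s) U (σ i))
    (hf : ∀ i, ContMDiffOn (MI n s) 𝓘(ℝ, ℝ) ∞ (f i) U)
    {x : M} (hx : x ∈ U) {φ : OpenPartialHomeomorph M (Model n s)}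
    (hφ : φ ∈ IsManifold.maximalAtlas (MI n s) ∞ M) (hxφ : x ∈ φ.source) (v w : Model n s) :
    nabla.curv (fun y => ∑ i ∈ A, f i y • σ i y) x (coordField φ v) (coordField φ w)
      = ∑ i ∈ A, f i x • nabla.curv (σ i) x (coordField φ v) (coordField φ w) := by
  classical
  induction A using Finset.induction_on with
  | empty =>
    have h0 : SmoothSecOn F E (n := n) (s := s) U (fun _ => 0) :=
      (contMDiff_zeroSection ℝ E).contMDiffOn
    have h := nabla.curv_smul hU h0 (f := fun _ => 0) contMDiffOn_const hx hφ hxφ v w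
    simpa using h
  | insert a A ha ih =>
    simp only [Finset.sum_insert ha]
    rw [← ih, ← nabla.curv_smul hU (hσ a) (hf a) hx hφ hxφ]
    have h1 : SmoothSecOn F E (n := n) (s := s) U (fun y => f a y • σ a y) :=
      (hf a).smul_section (hσ a)
    have h2 : SmoothSecOn F E (n := n) (s := s) U (fun y => ∑ i ∈ A, f i y • σ i y) :=
      ContMDiffOn.sum_section fun i _ => (hf i).smul_section (hσ i)
    exact nabla.curv_add hU h1 h2 hx (mdifferentiableAt_coordField hφ hxφ v)
      (mdifferentiableAt_coordField hφ hxφ w)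

/-- In a local frame, linearity over functions expresses the curvature through the coefficients of
the section at `x` alone. A real frame suffices here. -/
theorem curv_coordField_eq [FiniteDimensional ℂ F] [ContMDiffVectorBundle ∞ F E (MI n s)]
    {σ τ : Π x : M, E x} {U : Set M} (hU : IsOpen U)
    (hσ : SmoothSecOn F E (n := n) (s := s) U σ) (hτ : SmoothSecOn F E (n := n) (s := s) U τ)
    {x : M} (hx : x ∈ U) (h : σ x = τ x) {φ : OpenPartialHomeomorph M (Model n s)}
    (hφ : φ ∈ IsManifold.maximalAtlas (MI n s) ∞ M) (hxφ : x ∈ φ.source) (v w : Model n s) :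
    nabla.curv σ x (coordField φ v) (coordField φ w)
      = nabla.curv τ x (coordField φ v) (coordField φ w) := by
  have : ContMDiffVectorBundle 1 F E (MI n s) := ContMDiffVectorBundle.of_le (n := ∞) (by simp)
  let t := trivializationAt F E x
  have hxt : x ∈ t.baseSet := FiberBundle.mem_baseSet_trivializationAt F E x
  let b := Module.finBasis ℝ F
  set V := U ∩ t.baseSet with hV
  have hVo : IsOpen V := hU.inter t.open_baseSet
  have hxV : x ∈ V := ⟨hx, hxt⟩
  have hs : ∀ i, SmoothSecOn F E (n := n) (s := s) V (t.localFrame b i) := fun i =>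
    (t.contMDiffOn_localFrame_baseSet ∞ b i).mono inter_subset_right
  have key : ∀ {σ : Π x : M, E x}, SmoothSecOn F E (n := n) (s := s) U σ →
      nabla.curv σ x (coordField φ v) (coordField φ w)
        = ∑ i, t.localFrameCoeff (MI n s) b i x (σ x) •
          nabla.curv (t.localFrame b i) x (coordField φ v) (coordField φ w) := by
    intro σ hσ
    have hc : ∀ i, ContMDiffOn (MI n s) 𝓘(ℝ, ℝ) ∞
        (fun y => t.localFrameCoeff (MI n s) b i y (σ y)) V := fun i =>
      contMDiffOn_localFrameCoeff b hVo inter_subset_right (hσ.mono inter_subset_left) i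
    rw [← nabla.curv_sum_smul Finset.univ hVo hs hc hxV hφ hxφ]
    refine nabla.curv_congr hVo (hσ.mono inter_subset_left)
      (ContMDiffOn.sum_section fun i _ => (hc i).smul_section (hs i)) ?_ hxV
      (mdifferentiableAt_coordField hφ hxφ v) (mdifferentiableAt_coordField hφ hxφ w)
    intro y hy
    exact t.eq_sum_localFrameCoeff_smul (I := MI n s) (b := b) (s := σ) hy.2
  rw [key hσ, key hτ, h]

/-- The curvature depends only on the value of the section. -/
theorem curv_eq [FiniteDimensional ℂ F] [ContMDiffVectorBundle ∞ F E (MI n s)]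
    {σ τ : Π x : M, E x} {U V : Set M} (hU : IsOpen U) (hV : IsOpen V)
    (hσ : SmoothSecOn F E (n := n) (s := s) U σ) (hτ : SmoothSecOn F E (n := n) (s := s) V τ)
    {x : M} (hxU : x ∈ U) (hxV : x ∈ V) (h : σ x = τ x)
    {X Y : Π x : M, TangentSpace (MI n s) x} (hX : DiffField X x) (hY : DiffField Y x) :
    nabla.curv σ x X Y = nabla.curv τ x X Y := by
  set φ := chartAt (Model n s) x
  have hφ : φ ∈ IsManifold.maximalAtlas (MI n s) ∞ M := IsManifold.chart_mem_maximalAtlas x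
  have hxφ : x ∈ φ.source := mem_chart_source _ x
  -- Only the values at `x` of the two fields matter, so they may be replaced by coordinate fields.
  obtain ⟨v, hv⟩ : ∃ v, coordField φ v x = X x := ⟨_, coordField_mfderiv hφ hxφ (X x)⟩
  obtain ⟨w, hw⟩ : ∃ w, coordField φ w x = Y x := ⟨_, coordField_mfderiv hφ hxφ (Y x)⟩
  rw [← nabla.curvHom_apply hU hσ hxU hX hY, ← nabla.curvHom_apply hV hτ hxV hX hY, ← hv, ← hw,
    nabla.curvHom_apply hU hσ hxU (mdifferentiableAt_coordField hφ hxφ _)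
      (mdifferentiableAt_coordField hφ hxφ _),
    nabla.curvHom_apply hV hτ hxV (mdifferentiableAt_coordField hφ hxφ _)
      (mdifferentiableAt_coordField hφ hxφ _)]
  exact nabla.curv_coordField_eq (hU.inter hV) (hσ.mono inter_subset_left)
    (hτ.mono inter_subset_right) ⟨hxU, hxV⟩ h hφ hxφ _ _

/-- The curvature, computed with an arbitrary extension of the vector in the fiber. -/
theorem curvature_eq_curvHom [FiniteDimensional ℂ F] [ContMDiffVectorBundle ∞ F E (MI n s)]
    {σ : Π x : M, E x} {U : Set M} (hU : IsOpen U)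
    (hσ : SmoothSecOn F E (n := n) (s := s) U σ) {x : M} (hx : x ∈ U)
    (u v : TangentSpace (MI n s) x) :
    nabla.curvature u v (σ x) = nabla.curvHom hU hσ hx u v := by
  obtain ⟨V, hV, hVσ⟩ := FiberBundle.exists_contMDiffOn_extend (k := ∞) (MI n s) F (σ x)
  obtain ⟨W, hWV, hW, hxW⟩ := mem_nhds_iff.1 hV
  refine nabla.curv_eq (σ := FiberBundle.extend F (σ x)) hW hU (hVσ.mono hWV) hσ hxW hx ?_
    ?_ ?_
  · exact FiberBundle.extend_apply_self ..
  · exact FiberBundle.mdifferentiableAt_extend ..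
  · exact FiberBundle.mdifferentiableAt_extend ..

end Connection

end Curvature

/-! ### Complex vector fields -/

section ComplexFields

variable {n s : ℕ} {M : Type*} [TopologicalSpace M] [ChartedSpace (Model n s) M]

theorem reT_tmul (x : M) (c : ℂ) (u : TangentSpace (MI n s) x) :
    reT x (c ⊗ₜ[ℝ] u) = c.re • u := rfl

theorem imT_tmul (x : M) (c : ℂ) (u : TangentSpace (MI n s) x) :
    imT x (c ⊗ₜ[ℝ] u) = c.im • u := rfl

/-- A real tangent vector as a complex one. -/
def ofRealT (x : M) : TangentSpace (MI n s) x →ₗ[ℝ] CTangent n s x :=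
  TensorProduct.mk ℝ ℂ (TangentSpace (MI n s) x) 1

theorem tmul_eq_smul_ofRealT (x : M) (c : ℂ) (u : TangentSpace (MI n s) x) :
    c ⊗ₜ[ℝ] u = c • ofRealT x u := by
  rw [ofRealT, TensorProduct.mk_apply, TensorProduct.smul_tmul', smul_eq_mul, mul_one]

theorem eq_re_add_im (x : M) (z : CTangent n s x) :
    z = ofRealT x (reT x z) + Complex.I • ofRealT x (imT x z) := by
  induction z using TensorProduct.induction_on with
  | zero => simp
  | tmul c u =>
    rw [reT_tmul, imT_tmul, tmul_eq_smul_ofRealT, map_smul, map_smul]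
    conv_lhs => rw [← Complex.re_add_im c]
    rw [add_smul, mul_comm, mul_smul]
    rfl
  | add a b ha hb =>
    conv_lhs => rw [ha, hb]
    simp only [map_add, smul_add]
    abel

theorem reT_smul (x : M) (c : ℂ) (z : CTangent n s x) :
    reT x (c • z) = c.re • reT x z - c.im • imT x z := by
  induction z using TensorProduct.induction_on with
  | zero => simp
  | tmul d u =>
    rw [TensorProduct.smul_tmul', reT_tmul, reT_tmul, imT_tmul, smul_smul, smul_smul, ← sub_smul,
      smul_eq_mul, Complex.mul_re]
  | add a b ha hb => simp only [smul_add, map_add, ha, hb]; abel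

theorem imT_smul (x : M) (c : ℂ) (z : CTangent n s x) :
    imT x (c • z) = c.re • imT x z + c.im • reT x z := by
  induction z using TensorProduct.induction_on with
  | zero => simp
  | tmul d u =>
    rw [TensorProduct.smul_tmul', imT_tmul, reT_tmul, imT_tmul, smul_smul, smul_smul, ← add_smul,
      smul_eq_mul, Complex.mul_im]
  | add a b ha hb => simp only [smul_add, map_add, ha, hb]; abel

variable [IsManifold (MI n s) ∞ M]

/-- Differentiability at a point of a complex vector field. -/
def CDiff (Z : Π x : M, CTangent n s x) (x : M) : Prop :=
  DiffField (fun y => reT y (Z y)) x ∧ DiffField (fun y => imT y (Z y)) x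

theorem CDiff.congr {Z W : Π x : M, CTangent n s x} {x : M} (hZ : CDiff Z x)
    (h : ∀ᶠ y in 𝓝 x, W y = Z y) : CDiff W x := by
  refine ⟨hZ.1.congr_of_eventuallyEq ?_, hZ.2.congr_of_eventuallyEq ?_⟩ <;>
  · filter_upwards [h] with y hy
    rw [hy]

theorem CDiff.add {Z W : Π x : M, CTangent n s x} {x : M} (hZ : CDiff Z x) (hW : CDiff W x) :
    CDiff (fun y => Z y + W y) x := by
  constructor
  · have heq : (fun y => reT y (Z y + W y)) = (fun y => reT y (Z y)) + fun y => reT y (W y) :=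
      funext fun y => map_add _ _ _
    rw [heq]
    exact mdifferentiableAt_add_section hZ.1 hW.1
  · have heq : (fun y => imT y (Z y + W y)) = (fun y => imT y (Z y)) + fun y => imT y (W y) :=
      funext fun y => map_add _ _ _
    rw [heq]
    exact mdifferentiableAt_add_section hZ.2 hW.2

theorem CDiff.smul {Z : Π x : M, CTangent n s x} {f : M → ℂ} {x : M} (hZ : CDiff Z x)
    (hf : MDifferentiableAt (MI n s) 𝓘(ℝ, ℂ) f x) : CDiff (fun y => f y • Z y) x := by
  have hre : MDifferentiableAt (MI n s) 𝓘(ℝ, ℝ) (fun y => (f y).re) x :=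
    Complex.reCLM.mdifferentiableAt.comp x hf
  have him : MDifferentiableAt (MI n s) 𝓘(ℝ, ℝ) (fun y => (f y).im) x :=
    Complex.imCLM.mdifferentiableAt.comp x hf
  constructor
  · have heq : (fun y => reT y (f y • Z y))
        = (fun y => (f y).re • reT y (Z y)) - fun y => (f y).im • imT y (Z y) :=
      funext fun y => reT_smul _ _ _
    rw [heq]
    exact mdifferentiableAt_sub_section (hre.smul_section hZ.1) (him.smul_section hZ.2)
  · have heq : (fun y => imT y (f y • Z y))
        = (fun y => (f y).re • imT y (Z y)) + fun y => (f y).im • reT y (Z y) :=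
      funext fun y => imT_smul _ _ _
    rw [heq]
    exact mdifferentiableAt_add_section (hre.smul_section hZ.2) (him.smul_section hZ.1)

theorem CDiff.zero (x : M) : CDiff (n := n) (s := s) (fun _ : M => 0) x := by
  constructor
  · simp only [map_zero]
    exact mdifferentiable_zeroSection ℝ (TangentSpace (MI n s) : M → Type _) x
  · simp only [map_zero]
    exact mdifferentiable_zeroSection ℝ (TangentSpace (MI n s) : M → Type _) x

theorem CDiff.sum {κ : Type*} (A : Finset κ) {Z : κ → Π x : M, CTangent n s x} {x : M}
    (hZ : ∀ i, CDiff (Z i) x) : CDiff (fun y => ∑ i ∈ A, Z i y) x := by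
  classical
  induction A using Finset.induction_on with
  | empty => simpa using CDiff.zero x
  | insert a A ha ih => simpa only [Finset.sum_insert ha] using (hZ a).add ih

theorem cbracket_congr {Z Z' W W' : Π x : M, CTangent n s x} {x : M}
    (hZ : ∀ᶠ y in 𝓝 x, Z y = Z' y) (hW : ∀ᶠ y in 𝓝 x, W y = W' y) :
    cbracket Z W x = cbracket Z' W' x := by
  have h1 : (fun y => reT y (Z y)) =ᶠ[𝓝 x] (fun y => reT y (Z' y)) := by
    filter_upwards [hZ] with y hy; rw [hy]
  have h2 : (fun y => imT y (Z y)) =ᶠ[𝓝 x] (fun y => imT y (Z' y)) := by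
    filter_upwards [hZ] with y hy; rw [hy]
  have h3 : (fun y => reT y (W y)) =ᶠ[𝓝 x] (fun y => reT y (W' y)) := by
    filter_upwards [hW] with y hy; rw [hy]
  have h4 : (fun y => imT y (W y)) =ᶠ[𝓝 x] (fun y => imT y (W' y)) := by
    filter_upwards [hW] with y hy; rw [hy]
  simp only [cbracket]
  rw [h1.mlieBracket_vectorField_eq h3, h1.mlieBracket_vectorField_eq h4,
    h2.mlieBracket_vectorField_eq h3, h2.mlieBracket_vectorField_eq h4]

theorem cbracket_eq (Z W : Π x : M, CTangent n s x) (x : M) :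
    cbracket Z W x
      = ofRealT x (VectorField.mlieBracket (MI n s) (fun y => reT y (Z y)) (fun y => reT y (W y)) x)
      - ofRealT x (VectorField.mlieBracket (MI n s) (fun y => imT y (Z y)) (fun y => imT y (W y)) x)
      + Complex.I • (ofRealT x
          (VectorField.mlieBracket (MI n s) (fun y => reT y (Z y)) (fun y => imT y (W y)) x)
        + ofRealT x
          (VectorField.mlieBracket (MI n s) (fun y => imT y (Z y)) (fun y => reT y (W y)) x)) := by
  rw [← map_sub, ← map_add, ← tmul_eq_smul_ofRealT]
  rfl

theorem cbracket_add_left {Z Z' W : Π x : M, CTangent n s x} {x : M} (hZ : CDiff Z x)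
    (hZ' : CDiff Z' x) :
    cbracket (fun y => Z y + Z' y) W x = cbracket Z W x + cbracket Z' W x := by
  have h : ∀ V : Π x : M, TangentSpace (MI n s) x,
      VectorField.mlieBracket (MI n s) (fun y => reT y (Z y + Z' y)) V x
        = VectorField.mlieBracket (MI n s) (fun y => reT y (Z y)) V x
          + VectorField.mlieBracket (MI n s) (fun y => reT y (Z' y)) V x := fun V => by
    rw [← VectorField.mlieBracket_add_left hZ.1 hZ'.1]
    simp only [map_add]
    rfl
  have h' : ∀ V : Π x : M, TangentSpace (MI n s) x,
      VectorField.mlieBracket (MI n s) (fun y => imT y (Z y + Z' y)) V x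
        = VectorField.mlieBracket (MI n s) (fun y => imT y (Z y)) V x
          + VectorField.mlieBracket (MI n s) (fun y => imT y (Z' y)) V x := fun V => by
    rw [← VectorField.mlieBracket_add_left hZ.2 hZ'.2]
    simp only [map_add]
    rfl
  rw [cbracket_eq, cbracket_eq, cbracket_eq, h, h, h', h']
  simp only [map_add, smul_add]
  abel

theorem cderiv_ofRealT (f : M → ℂ) (x : M) (u : TangentSpace (MI n s) x) :
    cderiv f x (ofRealT x u) = mvfderiv (MI n s) f x u := by
  rw [ofRealT, TensorProduct.mk_apply, cderiv, LinearMap.liftBaseChange_tmul, one_smul]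
  rfl

/-- The complex Leibniz rule is deduced from the real one by splitting `f`, `Z` and `W` into real
and imaginary parts. -/
theorem cbracket_smul_left {Z W : Π x : M, CTangent n s x} {f : M → ℂ} {x : M} (hZ : CDiff Z x)
    (hf : MDifferentiableAt (MI n s) 𝓘(ℝ, ℂ) f x) :
    cbracket (fun y => f y • Z y) W x = f x • cbracket Z W x - cderiv f x (W x) • Z x := by
  have hre : HasMFDerivAt (MI n s) 𝓘(ℝ, ℝ) (fun y => (f y).re) x
      (Complex.reCLM.comp (mfderiv (MI n s) 𝓘(ℝ, ℂ) f x)) :=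
    Complex.reCLM.hasMFDerivAt.comp x hf.hasMFDerivAt
  have him : HasMFDerivAt (MI n s) 𝓘(ℝ, ℝ) (fun y => (f y).im) x
      (Complex.imCLM.comp (mfderiv (MI n s) 𝓘(ℝ, ℂ) f x)) :=
    Complex.imCLM.hasMFDerivAt.comp x hf.hasMFDerivAt
  have hdre : ∀ u, mvfderiv (MI n s) (fun y => (f y).re) x u = (mvfderiv (MI n s) f x u).re :=
    fun u => DFunLike.congr_fun hre.mfderiv u
  have hdim : ∀ u, mvfderiv (MI n s) (fun y => (f y).im) x u = (mvfderiv (MI n s) f x u).im :=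
    fun u => DFunLike.congr_fun him.mfderiv u
  have hneg : HasMFDerivAt (MI n s) 𝓘(ℝ, ℝ) (fun y => -(f y).im) x
      ((-Complex.imCLM).comp (mfderiv (MI n s) 𝓘(ℝ, ℂ) f x)) :=
    (-Complex.imCLM).hasMFDerivAt.comp x hf.hasMFDerivAt
  have hdneg : ∀ u, mvfderiv (MI n s) (fun y => -(f y).im) x u = -(mvfderiv (MI n s) f x u).im :=
    fun u => DFunLike.congr_fun hneg.mfderiv u
  -- The real field `V` stays arbitrary because both the real and the imaginary part of `W` are
  -- inserted below.
  have h : ∀ V : Π x : M, TangentSpace (MI n s) x,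
      VectorField.mlieBracket (MI n s) (fun y => reT y (f y • Z y)) V x
        = (f x).re • VectorField.mlieBracket (MI n s) (fun y => reT y (Z y)) V x
          - (mvfderiv (MI n s) f x (V x)).re • reT x (Z x)
          - ((f x).im • VectorField.mlieBracket (MI n s) (fun y => imT y (Z y)) V x
          - (mvfderiv (MI n s) f x (V x)).im • imT x (Z x)) := fun V => by
    -- The minus sign is absorbed in the coefficient `-(f y).im`, so that additivity of the bracket
    -- applies to a sum.
    have heq : (fun y => reT y (f y • Z y)) = (fun y => (f y).re) • (fun y => reT y (Z y))
        + (fun y => -(f y).im) • fun y => imT y (Z y) := by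
      funext y
      simp only [reT_smul, Pi.add_apply, Pi.smul_apply', neg_smul, sub_eq_add_neg]
    rw [heq, VectorField.mlieBracket_add_left (hre.mdifferentiableAt.smul_section hZ.1)
      (hneg.mdifferentiableAt.smul_section hZ.2),
      VectorField.mlieBracket_smul_left hre.mdifferentiableAt hZ.1,
      VectorField.mlieBracket_smul_left hneg.mdifferentiableAt hZ.2, hdre, hdneg]
    module
  have h' : ∀ V : Π x : M, TangentSpace (MI n s) x,
      VectorField.mlieBracket (MI n s) (fun y => imT y (f y • Z y)) V x
        = (f x).re • VectorField.mlieBracket (MI n s) (fun y => imT y (Z y)) V x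
          - (mvfderiv (MI n s) f x (V x)).re • imT x (Z x)
          + ((f x).im • VectorField.mlieBracket (MI n s) (fun y => reT y (Z y)) V x
          - (mvfderiv (MI n s) f x (V x)).im • reT x (Z x)) := fun V => by
    have heq : (fun y => imT y (f y • Z y)) = (fun y => (f y).re) • (fun y => imT y (Z y))
        + (fun y => (f y).im) • fun y => reT y (Z y) := by
      funext y
      simp only [imT_smul, Pi.add_apply, Pi.smul_apply']
    rw [heq, VectorField.mlieBracket_add_left (hre.mdifferentiableAt.smul_section hZ.2)
      (him.mdifferentiableAt.smul_section hZ.1),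
      VectorField.mlieBracket_smul_left hre.mdifferentiableAt hZ.2,
      VectorField.mlieBracket_smul_left him.mdifferentiableAt hZ.1, hdre, hdim]
    module
  have hW : cderiv f x (W x) = mvfderiv (MI n s) f x (reT x (W x))
      + Complex.I * mvfderiv (MI n s) f x (imT x (W x)) := by
    conv_lhs => rw [eq_re_add_im x (W x), map_add, map_smul, cderiv_ofRealT, cderiv_ofRealT]
    rfl
  have hr : ∀ (r : ℝ) (u : TangentSpace (MI n s) x), ofRealT x (r • u) = (r : ℂ) • ofRealT x u :=
    fun r u => map_smul _ _ _
  have hz := eq_re_add_im x (Z x)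
  rw [cbracket_eq, cbracket_eq, h, h, h', h', hW]
  conv_rhs => rw [hz]
  simp only [map_add, map_sub, hr]
  generalize mvfderiv (MI n s) f x (reT x (W x)) = a
  generalize mvfderiv (MI n s) f x (imT x (W x)) = b
  conv_rhs => rw [← Complex.re_add_im (f x), ← Complex.re_add_im a, ← Complex.re_add_im b]
  match_scalars <;> ring_nf <;>
    try (simp only [Complex.I_sq, Complex.I_pow_three]; ring)

end ComplexFields

/-! ### Curvature on complex vector fields -/

section ComplexSections

variable {n s : ℕ} {M : Type*} [TopologicalSpace M] [ChartedSpace (Model n s) M]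
  [IsManifold (MI n s) ∞ M]
  {F : Type*} [NormedAddCommGroup F] [NormedSpace ℂ F]
  {E : M → Type*} [TopologicalSpace (TotalSpace F E)] [∀ x, AddCommGroup (E x)]
  [∀ x, Module ℂ (E x)] [∀ x, TopologicalSpace (E x)] [FiberBundle F E] [VectorBundle ℂ F E]

/-- Differentiability is over `ℝ` while the scalars are complex. Trivializations are fiberwise
complex linear, so in one of them the product is the real bilinear map `lsmul ℝ ℂ` applied to two
differentiable functions. -/
theorem DiffSec.complex_smul {f : M → ℂ} {σ : Π x : M, E x} {x : M}
    (hσ : DiffSec (n := n) (s := s) F σ x) (hf : MDifferentiableAt (MI n s) 𝓘(ℝ, ℂ) f x) :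
    DiffSec (n := n) (s := s) F (fun y => f y • σ y) x := by
  rw [DiffSec, mdifferentiableAt_section] at hσ ⊢
  set e := trivializationAt F E x
  have h1 : MDifferentiableAt (MI n s) 𝓘(ℝ, F →L[ℝ] F)
      (fun y => ContinuousLinearMap.lsmul (E := F) ℝ ℂ (f y)) x :=
    (ContinuousLinearMap.lsmul (E := F) ℝ ℂ).mdifferentiableAt.comp x hf
  refine (h1.clm_apply hσ).congr_of_eventuallyEq ?_
  filter_upwards [e.open_baseSet.mem_nhds (mem_baseSet_trivializationAt F E x)] with y hy
  exact (e.linear ℂ hy).2 _ _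

theorem SmoothSecOn.complex_smul {f : M → ℂ} {σ : Π x : M, E x} {U : Set M}
    (hf : ContMDiffOn (MI n s) 𝓘(ℝ, ℂ) ∞ f U) (hσ : SmoothSecOn F E (n := n) (s := s) U σ) :
    SmoothSecOn F E (n := n) (s := s) U (fun y => f y • σ y) := by
  intro x hx
  have hσx := hσ x hx
  rw [contMDiffWithinAt_section] at hσx ⊢
  set e := trivializationAt F E x
  have h1 : ContMDiffWithinAt (MI n s) 𝓘(ℝ, F →L[ℝ] F) ∞
      (fun y => ContinuousLinearMap.lsmul (E := F) ℝ ℂ (f y)) U x :=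
    (ContinuousLinearMap.lsmul (E := F) ℝ ℂ).contMDiff.contMDiffAt.comp_contMDiffWithinAt x (hf x hx)
  refine (h1.clm_apply hσx).congr_of_eventuallyEq ?_ ?_
  · filter_upwards [mem_nhdsWithin_of_mem_nhds
      (e.open_baseSet.mem_nhds (mem_baseSet_trivializationAt F E x))] with y hy
    exact (e.linear ℂ hy).2 _ _
  · exact (e.linear ℂ (mem_baseSet_trivializationAt F E x)).2 _ _

theorem SmoothSecOn.diffSec {σ : Π x : M, E x} {U : Set M}
    (hσ : SmoothSecOn F E (n := n) (s := s) U σ) (hU : IsOpen U) {x : M} (hx : x ∈ U) :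
    DiffSec (n := n) (s := s) F σ x :=
  (hσ.contMDiffAt (hU.mem_nhds hx)).mdifferentiableAt (by simp)

variable [∀ x, IsTopologicalAddGroup (E x)] [∀ x, ContinuousSMul ℝ (E x)] [VectorBundle ℝ F E]
  (nabla : Connection n s F E)

namespace Connection

theorem toFun_const_smul {σ : Π x : M, E x} {x : M} (hσ : DiffSec (n := n) (s := s) F σ x) (c : ℂ)
    (u : TangentSpace (MI n s) x) :
    nabla.toFun (fun y => c • σ y) x u = c • nabla.toFun σ x u := by
  have h := nabla.leibniz_complex σ (fun _ => c) x hσ mdifferentiableAt_const u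
  rw [h]
  have h0 : mvfderiv (MI n s) (fun _ : M => c) x u = 0 := by
    rw [mvfderiv, mfderiv_const]
    rfl
  rw [h0, zero_smul, add_zero]

theorem along_ofRealT (σ : Π x : M, E x) (x : M) (u : TangentSpace (MI n s) x) :
    nabla.along σ x (ofRealT x u) = nabla.toFun σ x u := by
  rw [ofRealT, TensorProduct.mk_apply, along, LinearMap.liftBaseChange_tmul, one_smul]
  rfl

theorem along_eq (σ : Π x : M, E x) (x : M) (z : CTangent n s x) :
    nabla.along σ x z = nabla.toFun σ x (reT x z) + Complex.I • nabla.toFun σ x (imT x z) := by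
  conv_lhs => rw [eq_re_add_im x z, map_add, map_smul, along_ofRealT, along_ofRealT]

theorem along_congr {σ τ : Π x : M, E x} {x : M} (hσ : DiffSec (n := n) (s := s) F σ x)
    (hτ : DiffSec (n := n) (s := s) F τ x) (h : ∀ᶠ y in 𝓝 x, σ y = τ y) :
    nabla.along σ x = nabla.along τ x := by
  rw [along, along, nabla.toFun_congr hσ hτ h]

theorem diffSec_along {σ : Π x : M, E x} {U : Set M} (hU : IsOpen U)
    (hσ : SmoothSecOn F E (n := n) (s := s) U σ) {x : M} (hx : x ∈ U)
    {Z : Π x : M, CTangent n s x} (hZ : CDiff Z x) :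
    DiffSec (n := n) (s := s) F (fun y => nabla.along σ y (Z y)) x := by
  simp only [along_eq]
  exact mdifferentiableAt_add_section (nabla.diffSec_toFun hU hσ hx hZ.1)
    (DiffSec.complex_smul (nabla.diffSec_toFun hU hσ hx hZ.2) mdifferentiableAt_const)

theorem along_along {σ : Π x : M, E x} {U : Set M} (hU : IsOpen U)
    (hσ : SmoothSecOn F E (n := n) (s := s) U σ) {x : M} (hx : x ∈ U)
    {Z : Π x : M, CTangent n s x} (hZ : CDiff Z x) (u : TangentSpace (MI n s) x) :
    nabla.toFun (fun y => nabla.along σ y (Z y)) x u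
      = nabla.toFun (fun y => nabla.toFun σ y (reT y (Z y))) x u
        + Complex.I • nabla.toFun (fun y => nabla.toFun σ y (imT y (Z y))) x u := by
  have h2 := nabla.diffSec_toFun hU hσ hx hZ.2
  rw [← nabla.toFun_const_smul h2]
  simp only [along_eq]
  rw [nabla.toFun_add (nabla.diffSec_toFun hU hσ hx hZ.1)
    (DiffSec.complex_smul h2 mdifferentiableAt_const), add_apply]

/-- The curvature operator on complex vector fields. -/
def ccurv (σ : Π x : M, E x) (x : M) (Z W : Π y : M, CTangent n s y) : E x :=
  nabla.along (fun y => nabla.along σ y (W y)) x (Z x)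
    - nabla.along (fun y => nabla.along σ y (Z y)) x (W x)
    - nabla.along σ x (cbracket Z W x)

/-- The curvature at a point as a bilinear map, for a section that is smooth near the point. -/
def curvLin {σ : Π x : M, E x} {U : Set M} (hU : IsOpen U)
    (hσ : SmoothSecOn F E (n := n) (s := s) U σ) {x : M} (hx : x ∈ U) :
    TangentSpace (MI n s) x →ₗ[ℝ] TangentSpace (MI n s) x →ₗ[ℝ] E x :=
  LinearMap.mk₂ ℝ (fun u v => nabla.curvHom hU hσ hx u v) (fun _ _ _ => by simp)
    (fun _ _ _ => by simp) (fun _ _ _ => by simp) (fun _ _ _ => by simp)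

/-- This is the bridge from computations with complex fields to the tensor at `x`: the left side is
evaluated with sections of `𝓕` and the fields `∂/∂z̄ₖ`, and the right side depends only on their
values. Both sides expand into the same four real curvatures. -/
theorem ccurv_eq {σ : Π x : M, E x} {U : Set M} (hU : IsOpen U)
    (hσ : SmoothSecOn F E (n := n) (s := s) U σ) {x : M} (hx : x ∈ U)
    {Z W : Π x : M, CTangent n s x} (hZ : CDiff Z x) (hW : CDiff W x) :
    nabla.ccurv σ x Z W = complexify₂ (nabla.curvLin hU hσ hx) (Z x) (W x) := by
  have hK : ∀ {X Y : Π x : M, TangentSpace (MI n s) x}, DiffField X x → DiffField Y x →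
      complexify₂ (nabla.curvLin hU hσ hx) (ofRealT x (X x)) (ofRealT x (Y x))
        = nabla.curv σ x X Y := fun hX hY => by
    rw [← nabla.curvHom_apply hU hσ hx hX hY]
    refine (complexify₂_tmul _ _ _ _ _).trans ?_
    rw [mul_one, one_smul]
    rfl
  have hz := eq_re_add_im x (Z x)
  have hw := eq_re_add_im x (W x)
  conv_rhs => rw [hz, hw]
  simp only [map_add, map_smul, LinearMap.add_apply, LinearMap.smul_apply]
  rw [hK hZ.1 hW.1, hK hZ.1 hW.2, hK hZ.2 hW.1, hK hZ.2 hW.2]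
  rw [ccurv, along_eq, nabla.along_along hU hσ hx hW, nabla.along_along hU hσ hx hW,
    nabla.along_eq (fun y => nabla.along σ y (Z y)),
    nabla.along_along hU hσ hx hZ, nabla.along_along hU hσ hx hZ, cbracket_eq]
  simp only [map_add, map_sub, map_smul, along_ofRealT, curv]
  match_scalars <;> simp

end Connection

end ComplexSections

/-! ### Holomorphic and antiholomorphic vectors of a chart -/

section HolVec

variable {n s : ℕ} {M : Type*} [TopologicalSpace M] [ChartedSpace (Model n s) M]
  (φ : OpenPartialHomeomorph M (Model n s))

theorem coordField_add (v w : Model n s) (x : M) :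
    coordField φ (v + w) x = coordField φ v x + coordField φ w x := map_add _ _ _

theorem coordField_smul (r : ℝ) (v : Model n s) (x : M) :
    coordField φ (r • v) x = r • coordField φ v x := map_smul _ _ _

theorem chartVec_eq_coordField (x : M) (a : Fin n → ℂ) :
    chartVec φ x a = coordField φ (a, 0) x := rfl

theorem chartVec_add (x : M) (a b : Fin n → ℂ) :
    chartVec φ x (a + b) = chartVec φ x a + chartVec φ x b := by
  rw [chartVec_eq_coordField, chartVec_eq_coordField, chartVec_eq_coordField, ← coordField_add,
    Prod.mk_add_mk, add_zero]

theorem chartVec_smul (x : M) (r : ℝ) (a : Fin n → ℂ) :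
    chartVec φ x (r • a) = r • chartVec φ x a := by
  rw [chartVec_eq_coordField, chartVec_eq_coordField, ← coordField_smul, Prod.smul_mk, smul_zero]

/-- The real vectors with components `(a, 0)` in the chart `φ`, as a linear map in `a`. -/
def chartVecₗ (x : M) : (Fin n → ℂ) →ₗ[ℝ] CTangent n s x :=
  ofRealT x ∘ₗ { toFun := chartVec φ x, map_add' := chartVec_add φ x, map_smul' := chartVec_smul φ x }

theorem chartVecₗ_apply (x : M) (a : Fin n → ℂ) : chartVecₗ φ x a = ofRealT x (chartVec φ x a) := rfl

theorem smul_eq_re_add_im {A : Type*} [AddCommGroup A] [Module ℂ A] (c : ℂ) (a : A) :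
    c • a = c.re • a + c.im • (Complex.I • a) := by
  conv_lhs => rw [← Complex.re_add_im c, add_smul, mul_smul]
  rfl

/-- The complex vector `∑ aₖ ∂/∂zₖ`. -/
def holVec (x : M) : (Fin n → ℂ) →ₗ[ℂ] CTangent n s x where
  toFun a := (1 / 2 : ℂ) • (chartVecₗ φ x a - Complex.I • chartVecₗ φ x (Complex.I • a))
  map_add' a b := by
    simp only [smul_add, map_add]
    module
  map_smul' c a := by
    have h : Complex.I • c • a = c.re • (Complex.I • a) - c.im • a := by
      rw [smul_eq_re_add_im c a, smul_add, smul_comm _ c.im, smul_smul Complex.I Complex.I,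
        Complex.I_mul_I, smul_comm Complex.I c.re, neg_one_smul, smul_neg, sub_eq_add_neg]
    rw [h, smul_eq_re_add_im c a, map_add, map_sub, LinearMap.map_smul, LinearMap.map_smul,
      LinearMap.map_smul, LinearMap.map_smul, RingHom.id_apply]
    generalize chartVecₗ φ x a = u
    generalize chartVecₗ φ x (Complex.I • a) = v
    rw [smul_eq_re_add_im c]
    match_scalars
    · simp
      ring
    · simp
      linear_combination (c.im / 2 : ℂ) * Complex.I_mul_I

theorem holVec_apply (x : M) (a : Fin n → ℂ) : holVec φ x a
    = (1 / 2 : ℂ) • (chartVecₗ φ x a - Complex.I • chartVecₗ φ x (Complex.I • a)) := rfl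

/-- The complex vector `∑ āₖ ∂/∂z̄ₖ`. -/
def antiVec (x : M) (a : Fin n → ℂ) : CTangent n s x :=
  (1 / 2 : ℂ) • (chartVecₗ φ x a + Complex.I • chartVecₗ φ x (Complex.I • a))

theorem antiVec_add (x : M) (a b : Fin n → ℂ) :
    antiVec φ x (a + b) = antiVec φ x a + antiVec φ x b := by
  simp only [antiVec, smul_add, map_add]
  module

theorem antiVec_smul (x : M) (c : ℂ) (a : Fin n → ℂ) :
    antiVec φ x (c • a) = (starRingEnd ℂ) c • antiVec φ x a := by
  have h : Complex.I • c • a = c.re • (Complex.I • a) - c.im • a := by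
    rw [smul_eq_re_add_im c a, smul_add, smul_comm _ c.im, smul_smul Complex.I Complex.I,
      Complex.I_mul_I, smul_comm Complex.I c.re, neg_one_smul, smul_neg, sub_eq_add_neg]
  rw [antiVec, antiVec, h, smul_eq_re_add_im c a, map_add, map_sub, LinearMap.map_smul,
    LinearMap.map_smul, LinearMap.map_smul, LinearMap.map_smul]
  generalize chartVecₗ φ x a = u
  generalize chartVecₗ φ x (Complex.I • a) = v
  rw [smul_eq_re_add_im ((starRingEnd ℂ) c)]
  match_scalars
  · simp
    ring
  · simp
    linear_combination (c.im / 2 : ℂ) * Complex.I_mul_I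

theorem I_smul_single (k : Fin n) :
    Complex.I • (Pi.single k 1 : Fin n → ℂ) = Pi.single k Complex.I := by
  rw [← Pi.single_smul, smul_eq_mul, mul_one]

theorem ddz_eq_holVec (k : Fin n) (x : M) : ddz φ k x = holVec φ x (Pi.single k 1) := by
  rw [holVec_apply, I_smul_single, chartVecₗ_apply, chartVecₗ_apply, ← tmul_eq_smul_ofRealT]
  rfl

theorem ddzbar_eq_antiVec (k : Fin n) (x : M) : ddzbar φ k x = antiVec φ x (Pi.single k 1) := by
  rw [antiVec, I_smul_single, chartVecₗ_apply, chartVecₗ_apply, ← tmul_eq_smul_ofRealT]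
  rfl

theorem holVec_eq_sum (x : M) (a : Fin n → ℂ) : holVec φ x a = ∑ k, a k • ddz φ k x := by
  simp only [ddz_eq_holVec, ← map_smul, ← map_sum, ← Pi.single_smul, smul_eq_mul, mul_one]
  rw [Finset.univ_sum_single]

theorem antiVec_eq_sum (x : M) (a : Fin n → ℂ) :
    antiVec φ x a = ∑ k, (starRingEnd ℂ) (a k) • ddzbar φ k x := by
  have hs : ∀ A : Finset (Fin n), ∑ k ∈ A, antiVec φ x (Pi.single k (a k))
      = antiVec φ x (∑ k ∈ A, Pi.single k (a k)) := fun A => by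
    classical
    induction A using Finset.induction_on with
    | empty => simp [antiVec]
    | insert k A hk ih => rw [Finset.sum_insert hk, Finset.sum_insert hk, ih, antiVec_add]
  simp only [ddzbar_eq_antiVec, ← antiVec_smul, ← Pi.single_smul, smul_eq_mul, mul_one]
  rw [hs, Finset.univ_sum_single]

/-- The splitting of a real vertical vector into its parts of type (1,0) and (0,1); the terms
containing `I • a` cancel. -/
theorem ofRealT_chartVec (x : M) (a : Fin n → ℂ) :
    ofRealT x (chartVec φ x a) = holVec φ x a + antiVec φ x a := by
  rw [holVec_apply, antiVec, ← chartVecₗ_apply]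
  module

theorem reT_ddz (k : Fin n) (x : M) :
    reT x (ddz φ k x) = coordField φ (((1 / 2 : ℝ) • Pi.single k 1, 0) : Model n s) x := by
  rw [← chartVec_eq_coordField, chartVec_smul, ddz, reT_smul, map_sub, map_sub, reT_tmul, imT_tmul,
    reT_tmul, imT_tmul]
  simp

theorem imT_ddz (k : Fin n) (x : M) :
    imT x (ddz φ k x) = coordField φ (((-1 / 2 : ℝ) • Pi.single k Complex.I, 0) : Model n s) x := by
  rw [← chartVec_eq_coordField, chartVec_smul, ddz, imT_smul, map_sub, map_sub, reT_tmul, imT_tmul,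
    reT_tmul, imT_tmul]
  simp
  module

theorem reT_ddzbar (k : Fin n) (x : M) :
    reT x (ddzbar φ k x) = coordField φ (((1 / 2 : ℝ) • Pi.single k 1, 0) : Model n s) x := by
  rw [← chartVec_eq_coordField, chartVec_smul, ddzbar, reT_smul, map_add, map_add, reT_tmul,
    imT_tmul, reT_tmul, imT_tmul]
  simp

theorem imT_ddzbar (k : Fin n) (x : M) :
    imT x (ddzbar φ k x) = coordField φ (((1 / 2 : ℝ) • Pi.single k Complex.I, 0) : Model n s) x := by
  rw [← chartVec_eq_coordField, chartVec_smul, ddzbar, imT_smul, map_add, map_add, reT_tmul,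
    imT_tmul, reT_tmul, imT_tmul]
  simp

variable [IsManifold (MI n s) ∞ M] {φ}

theorem CDiff.ddz (hφ : φ ∈ IsManifold.maximalAtlas (MI n s) ∞ M) {x : M} (hx : x ∈ φ.source)
    (k : Fin n) : CDiff (DefFol.ddz φ k) x := by
  constructor
  · simp only [reT_ddz]
    exact mdifferentiableAt_coordField hφ hx _
  · simp only [imT_ddz]
    exact mdifferentiableAt_coordField hφ hx _

theorem CDiff.ddzbar (hφ : φ ∈ IsManifold.maximalAtlas (MI n s) ∞ M) {x : M} (hx : x ∈ φ.source)
    (k : Fin n) : CDiff (DefFol.ddzbar φ k) x := by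
  constructor
  · simp only [reT_ddzbar]
    exact mdifferentiableAt_coordField hφ hx _
  · simp only [imT_ddzbar]
    exact mdifferentiableAt_coordField hφ hx _

/-- Real and imaginary parts of both fields are coordinate fields, so all four real brackets vanish.
-/
theorem cbracket_ddz_ddzbar (hφ : φ ∈ IsManifold.maximalAtlas (MI n s) ∞ M) {x : M}
    (hx : x ∈ φ.source) (k l : Fin n) : cbracket (ddz φ k) (ddzbar φ l) x = 0 := by
  have h : ∀ v w : Model n s, VectorField.mlieBracket (MI n s) (fun y => coordField φ v y)
      (fun y => coordField φ w y) x = 0 := mlieBracket_coordField hφ hx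
  simp only [cbracket_eq, reT_ddz, reT_ddzbar, imT_ddz, imT_ddzbar, h, map_zero, sub_zero, add_zero,
    smul_zero]

theorem cbracket_ddzbar_ddzbar (hφ : φ ∈ IsManifold.maximalAtlas (MI n s) ∞ M) {x : M}
    (hx : x ∈ φ.source) (k l : Fin n) : cbracket (ddzbar φ k) (ddzbar φ l) x = 0 := by
  have h : ∀ v w : Model n s, VectorField.mlieBracket (MI n s) (fun y => coordField φ v y)
      (fun y => coordField φ w y) x = 0 := mlieBracket_coordField hφ hx
  simp only [cbracket_eq, reT_ddzbar, imT_ddzbar, h, map_zero, sub_zero, add_zero, smul_zero]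

end HolVec

/-! ### Functions that are holomorphic along the fibers -/

section Complex

/-- The restriction of the real derivative to a complex slice is complex linear if the function is
holomorphic on the slice. -/
theorem fderiv_I_smul_of_differentiableAt {Z S G : Type*} [NormedAddCommGroup Z] [NormedSpace ℂ Z]
    [NormedAddCommGroup S] [NormedSpace ℝ S] [NormedAddCommGroup G] [NormedSpace ℂ G]
    {g : Z × S → G} {p : Z × S} (hg : DifferentiableAt ℝ g p)
    (hz : DifferentiableAt ℂ (fun z => g (z, p.2)) p.1) (c : ℂ) (a : Z) :
    fderiv ℝ g p (c • a, 0) = c • fderiv ℝ g p (a, 0) := by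
  have h1 : HasFDerivAt (fun z => g (z, p.2))
      ((fderiv ℝ g p).comp (ContinuousLinearMap.inl ℝ Z S)) p.1 :=
    HasFDerivAt.comp p.1 (f := fun z => (z, p.2)) hg.hasFDerivAt (hasFDerivAt_prodMk_left p.1 p.2)
  have h2 := h1.unique (hz.hasFDerivAt.restrictScalars ℝ)
  have h3 : ∀ a, fderiv ℝ g p (a, 0) = fderiv ℂ (fun z => g (z, p.2)) p.1 a := fun a =>
    DFunLike.congr_fun h2 a
  rw [h3, h3, map_smul]

/-- Compatibility with multiplication by `I` makes the real derivative along the slice complex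
linear, hence a complex derivative. -/
theorem differentiableAt_slice {Z S G : Type*} [NormedAddCommGroup Z] [NormedSpace ℂ Z]
    [NormedAddCommGroup S] [NormedSpace ℝ S] [NormedAddCommGroup G] [NormedSpace ℂ G]
    {g : Z × S → G} {p : Z × S} (hg : DifferentiableAt ℝ g p)
    (h : ∀ a : Z, fderiv ℝ g p (Complex.I • a, 0) = Complex.I • fderiv ℝ g p (a, 0)) :
    DifferentiableAt ℂ (fun z => g (z, p.2)) p.1 := by
  have h1 : HasFDerivAt (fun z => g (z, p.2))
      ((fderiv ℝ g p).comp (ContinuousLinearMap.inl ℝ Z S)) p.1 :=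
    HasFDerivAt.comp p.1 (f := fun z => (z, p.2)) hg.hasFDerivAt (hasFDerivAt_prodMk_left p.1 p.2)
  set L := (fderiv ℝ g p).comp (ContinuousLinearMap.inl ℝ Z S) with hL
  have hLI : ∀ a, L (Complex.I • a) = Complex.I • L a := h
  let L' : Z →L[ℂ] G :=
    { toFun := L
      map_add' := map_add L
      map_smul' := fun c a => by
        rw [smul_eq_re_add_im c a, map_add, map_smul, map_smul, hLI, RingHom.id_apply,
          smul_eq_re_add_im c (L a)]
      cont := L.cont }
  exact (hasFDerivAt_of_restrictScalars ℝ (g' := L) (f' := L') h1 rfl).differentiableAt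

end Complex

namespace Deformation

section

variable {n s : ℕ} {M : Type*} [TopologicalSpace M] [ChartedSpace (Model n s) M]
  [IsManifold (MI n s) ∞ M] {P : Type*} [TopologicalSpace P]
  [ChartedSpace (EuclideanSpace ℝ (Fin s)) P] [IsManifold (𝓡 s) ∞ P]
  {D : Deformation n s M P} {U V : Set M} {f g : M → ℂ}

/-! ### Functions and vector fields that are holomorphic along the fibers -/

theorem IsO.mono (hf : D.IsO U f) (h : V ⊆ U) : D.IsO V f :=
  ⟨hf.smooth.mono h, fun φ hφ t => (hf.holomorphic φ hφ t).mono fun _ hz => ⟨hz.1, h hz.2⟩⟩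

theorem isO_const (c : ℂ) : D.IsO U fun _ => c :=
  ⟨contMDiffOn_const, fun _ _ _ => differentiableOn_const c⟩

theorem IsO.add (hf : D.IsO U f) (hg : D.IsO U g) : D.IsO U fun y => f y + g y :=
  ⟨hf.smooth.add hg.smooth, fun φ hφ t => (hf.holomorphic φ hφ t).add (hg.holomorphic φ hφ t)⟩

theorem IsO.mul (hf : D.IsO U f) (hg : D.IsO U g) : D.IsO U fun y => f y * g y :=
  ⟨((ContinuousLinearMap.mul ℝ ℂ).contMDiff.comp_contMDiffOn hf.smooth).clm_apply hg.smooth,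
    fun φ hφ t => (hf.holomorphic φ hφ t).mul (hg.holomorphic φ hφ t)⟩

theorem IsO.sum {κ : Type*} (A : Finset κ) {f : κ → M → ℂ} (hf : ∀ k, D.IsO U (f k)) :
    D.IsO U fun y => ∑ k ∈ A, f k y := by
  classical
  induction A using Finset.induction_on with
  | empty => simpa using isO_const (D := D) (U := U) 0
  | insert k A hk ih => simpa only [Finset.sum_insert hk] using (hf k).add ih

theorem IsO.mdifferentiableAt (hf : D.IsO U f) (hU : IsOpen U) {x : M} (hx : x ∈ U) :
    MDifferentiableAt (MI n s) 𝓘(ℝ, ℂ) f x :=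
  (hf.smooth.contMDiffAt (hU.mem_nhds hx)).mdifferentiableAt (by simp)

/-! ### Cauchy–Riemann equations, vertical vectors and changes of adapted charts -/

variable {φ φ' : OpenPartialHomeomorph M (Model n s)}

theorem IsO.mvfderiv_chartVec (hf : D.IsO U f) (hU : IsOpen U) {x : M} (hx : x ∈ U)
    (hφ : φ ∈ D.charts) (hxφ : x ∈ φ.source) (c : ℂ) (a : Fin n → ℂ) :
    mvfderiv (MI n s) f x (chartVec φ x (c • a)) = c * mvfderiv (MI n s) f x (chartVec φ x a) := by
  have hφ' := D.charts_subset hφ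
  rw [chartVec_eq_coordField, chartVec_eq_coordField,
    mvfderiv_coordField hφ' hxφ _ (hf.mdifferentiableAt hU hx),
    mvfderiv_coordField hφ' hxφ _ (hf.mdifferentiableAt hU hx)]
  refine fderiv_I_smul_of_differentiableAt (p := φ x)
    ((contDiffAt_comp_symm hφ' hxφ (hf.smooth.contMDiffAt (hU.mem_nhds hx))).differentiableAt
      (by simp)) ?_ c a
  refine (hf.holomorphic φ hφ (φ x).2).differentiableAt ?_
  -- The slice of the chart domain at fixed `t` is open in `ℂⁿ`, so differentiability on it is
  -- differentiability at its points.
  refine ((φ.isOpen_inter_preimage_symm hU).preimage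
    (Continuous.prodMk_left (φ x).2)).mem_nhds ?_
  exact ⟨φ.map_source hxφ, by simpa [φ.left_inv hxφ] using hx⟩

/-- Holomorphy along the fibers can be tested on first derivatives. This form suits functions that
are themselves derivatives. -/
theorem isO_of_mvfderiv (hU : IsOpen U) (hf : ContMDiffOn (MI n s) 𝓘(ℝ, ℂ) ∞ f U)
    (h : ∀ φ ∈ D.charts, ∀ x ∈ U, x ∈ φ.source → ∀ a : Fin n → ℂ,
      mvfderiv (MI n s) f x (chartVec φ x (Complex.I • a))
        = Complex.I * mvfderiv (MI n s) f x (chartVec φ x a)) : D.IsO U f := by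
  refine ⟨hf, fun φ hφ t z hz => ?_⟩
  have hφ' := D.charts_subset hφ
  obtain ⟨hzt, hzU⟩ := hz
  set x := φ.symm (z, t) with hx
  have hxφ : x ∈ φ.source := φ.map_target hzt
  have hφx : φ x = (z, t) := φ.right_inv hzt
  have hfx := hf.contMDiffAt (hU.mem_nhds hzU)
  have hd : DifferentiableAt ℝ (f ∘ φ.symm) (z, t) := by
    rw [← hφx]
    exact (contDiffAt_comp_symm hφ' hxφ hfx).differentiableAt (by simp)
  refine (differentiableAt_slice hd fun a => ?_).differentiableWithinAt
  have := h φ hφ x hzU hxφ a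
  rwa [chartVec_eq_coordField, chartVec_eq_coordField,
    mvfderiv_coordField hφ' hxφ _ (hfx.mdifferentiableAt (by simp)),
    mvfderiv_coordField hφ' hxφ _ (hfx.mdifferentiableAt (by simp)), hφx] at this

/-- The Cauchy–Riemann equations. -/
theorem IsO.cderiv_ddzbar (hf : D.IsO U f) (hU : IsOpen U) {x : M} (hx : x ∈ U)
    (hφ : φ ∈ D.charts) (hxφ : x ∈ φ.source) (k : Fin n) : cderiv f x (ddzbar φ k x) = 0 := by
  rw [ddzbar_eq_antiVec, antiVec, map_smul, map_add, map_smul, chartVecₗ_apply, chartVecₗ_apply,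
    cderiv_ofRealT, cderiv_ofRealT, hf.mvfderiv_chartVec hU hx hφ hxφ, smul_eq_mul, smul_eq_mul,
    ← mul_assoc, Complex.I_mul_I]
  ring

/-- In an adapted chart the coordinate `t` is `ψ ∘ π` with `ψ` a chart of `P`. Since `dψ` is
injective, `dt` and `dπ` have the same kernel. -/
theorem mem_vertical_iff (hφ : φ ∈ D.charts) {x : M} (hx : x ∈ φ.source)
    (u : TangentSpace (MI n s) x) :
    u ∈ D.vertical x ↔ (mfderiv (MI n s) 𝓘(ℝ, Model n s) φ x u : Model n s).2 = 0 := by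
  obtain ⟨A, V, -, -, -, ψ, hψ, hψs, -, hψφ⟩ := D.product φ hφ
  have hmd := mdifferentiable_of_mem_maximalAtlas (D.charts_subset hφ)
  have hxψ : D.proj x ∈ ψ.source := hψs ▸ mem_image_of_mem _ hx
  have hψd : ψ.MDifferentiable (𝓡 s) (𝓡 s) :=
    ⟨(contMDiffOn_of_mem_maximalAtlas hψ).mdifferentiableOn (by simp),
      (contMDiffOn_symm_of_mem_maximalAtlas hψ).mdifferentiableOn (by simp)⟩
  have h1 : (fun y => (φ y).2) =ᶠ[𝓝 x] ψ ∘ D.proj := by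
    filter_upwards [φ.open_source.mem_nhds hx] with y hy
    exact (hψφ y hy).symm
  have h2 : HasMFDerivAt (MI n s) (𝓡 s) (fun y => (φ y).2) x
      ((mfderiv (𝓡 s) (𝓡 s) ψ (D.proj x)).comp (mfderiv (MI n s) (𝓡 s) D.proj x)) :=
    ((hψd.mdifferentiableAt hxψ).hasMFDerivAt.comp x
      (D.contMDiff.mdifferentiable (by simp) x).hasMFDerivAt).congr_of_eventuallyEq h1
  have h3 : HasMFDerivAt (MI n s) (𝓡 s) (fun y => (φ y).2) x
      ((ContinuousLinearMap.snd ℝ (Fin n → ℂ) (EuclideanSpace ℝ (Fin s))).comp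
        (mfderiv (MI n s) 𝓘(ℝ, Model n s) φ x)) :=
    (ContinuousLinearMap.snd ℝ (Fin n → ℂ) (EuclideanSpace ℝ (Fin s))).hasMFDerivAt.comp x
      (hmd.mdifferentiableAt hx).hasMFDerivAt
  have h4 : (mfderiv (MI n s) 𝓘(ℝ, Model n s) φ x u : Model n s).2
      = mfderiv (𝓡 s) (𝓡 s) ψ (D.proj x) (mfderiv (MI n s) (𝓡 s) D.proj x u) :=
    DFunLike.congr_fun (hasMFDerivAt_unique h3 h2) u
  rw [h4]
  have hinj : Function.Injective (mfderiv (𝓡 s) (𝓡 s) ψ (D.proj x)) :=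
    hψd.mfderiv_injective hxψ
  exact ((map_eq_zero_iff _ hinj).symm : _)

theorem chartVec_mem_vertical (hφ : φ ∈ D.charts) {x : M} (hx : x ∈ φ.source) (a : Fin n → ℂ) :
    chartVec φ x a ∈ D.vertical x := by
  rw [mem_vertical_iff hφ hx, chartVec_eq_coordField, mfderiv_coordField (D.charts_subset hφ) hx]

theorem eq_chartVec_of_mem_vertical (hφ : φ ∈ D.charts) {x : M} (hx : x ∈ φ.source)
    {u : TangentSpace (MI n s) x} (hu : u ∈ D.vertical x) :
    u = chartVec φ x (mfderiv (MI n s) 𝓘(ℝ, Model n s) φ x u : Model n s).1 := by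
  rw [mem_vertical_iff hφ hx] at hu
  rw [chartVec_eq_coordField, ← hu]
  exact (coordField_mfderiv (D.charts_subset hφ) hx u).symm

/-- The first component of the derivative of a chart, as a linear map. -/
def dz (φ : OpenPartialHomeomorph M (Model n s)) (x : M) :
    TangentSpace (MI n s) x →ₗ[ℝ] (Fin n → ℂ) :=
  (ContinuousLinearMap.fst ℝ (Fin n → ℂ) (EuclideanSpace ℝ (Fin s))).toLinearMap ∘ₗ
    (mfderiv (MI n s) 𝓘(ℝ, Model n s) φ x).toLinearMap

theorem chartVec_dz (hφ : φ ∈ D.charts) {x : M} (hx : x ∈ φ.source)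
    {u : TangentSpace (MI n s) x} (hu : u ∈ D.vertical x) : chartVec φ x (dz φ x u) = u :=
  (eq_chartVec_of_mem_vertical hφ hx hu).symm

theorem mvfderiv_coord (hφ : φ ∈ D.charts) {x : M} (hx : x ∈ φ.source)
    (u : TangentSpace (MI n s) x) (l : Fin n) :
    mvfderiv (MI n s) (fun y => (φ y).1 l) x u = dz φ x u l := by
  have hmd := mdifferentiable_of_mem_maximalAtlas (D.charts_subset hφ)
  have h : HasMFDerivAt (MI n s) 𝓘(ℝ, ℂ) (fun y => (φ y).1 l) x
      (((ContinuousLinearMap.proj (R := ℝ) (φ := fun _ : Fin n => ℂ) l).comp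
        (ContinuousLinearMap.fst ℝ (Fin n → ℂ) (EuclideanSpace ℝ (Fin s)))).comp
        (mfderiv (MI n s) 𝓘(ℝ, Model n s) φ x)) :=
    ((ContinuousLinearMap.proj (R := ℝ) (φ := fun _ : Fin n => ℂ) l).comp
        (ContinuousLinearMap.fst ℝ (Fin n → ℂ) (EuclideanSpace ℝ (Fin s)))).hasMFDerivAt.comp x
      (hmd.mdifferentiableAt hx).hasMFDerivAt
  exact DFunLike.congr_fun h.mfderiv u

theorem isO_coord (hφ : φ ∈ D.charts) (l : Fin n) : D.IsO φ.source fun y => (φ y).1 l := by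
  refine ⟨?_, fun φ' hφ' t => ?_⟩
  · exact ((ContinuousLinearMap.proj (R := ℝ) (φ := fun _ : Fin n => ℂ) l).comp
      (ContinuousLinearMap.fst ℝ (Fin n → ℂ)
        (EuclideanSpace ℝ (Fin s)))).contMDiff.comp_contMDiffOn
        (contMDiffOn_of_mem_maximalAtlas (D.charts_subset hφ))
  · exact differentiableOn_pi.1 (D.holomorphic φ' hφ' φ hφ t) l

/-- The coordinate functions of `φ` belong to `Õ`, so the Cauchy–Riemann equations in the chart `φ'`
apply to them and give complex linearity of the change of coordinates on vertical vectors. -/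
theorem dz_chartVec_smul (hφ : φ ∈ D.charts) (hφ' : φ' ∈ D.charts) {x : M} (hx : x ∈ φ.source)
    (hx' : x ∈ φ'.source) (c : ℂ) (a : Fin n → ℂ) :
    dz φ x (chartVec φ' x (c • a)) = c • dz φ x (chartVec φ' x a) := by
  funext l
  rw [← mvfderiv_coord hφ hx, Pi.smul_apply, ← mvfderiv_coord hφ hx,
    (isO_coord hφ l).mvfderiv_chartVec φ.open_source hx hφ' hx', smul_eq_mul]

/-- The derivative of a fiberwise holomorphic function along a vertical coordinate field. -/
theorem IsO.deriv_chartVec (hf : D.IsO U f) (hU : IsOpen U) (hφ : φ ∈ D.charts) (a : Fin n → ℂ)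
    (hUφ : U ⊆ φ.source) : D.IsO U fun y => mvfderiv (MI n s) f y (chartVec φ y a) := by
  have hφm := D.charts_subset hφ
  have hsm : ∀ b : Fin n → ℂ, ∀ x ∈ U, ContMDiffAt (MI n s) 𝓘(ℝ, ℂ) ∞
      (fun y => mvfderiv (MI n s) f y (chartVec φ y b)) x := fun b x hx =>
    contMDiffAt_mvfderiv_coordField hφm hU hx (hUφ hx) _ hf.smooth
  refine isO_of_mvfderiv hU (fun x hx => (hsm a x hx).contMDiffWithinAt) ?_
  -- In the chart `φ` itself the two derivatives can be exchanged, so that `I • b` acts first on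
  -- `f`, where the Cauchy–Riemann equations hold in a neighbourhood.
  have key : ∀ x ∈ U, ∀ b : Fin n → ℂ,
      mvfderiv (MI n s) (fun y => mvfderiv (MI n s) f y (chartVec φ y a)) x
          (chartVec φ x (Complex.I • b))
        = Complex.I * mvfderiv (MI n s)
          (fun y => mvfderiv (MI n s) f y (chartVec φ y a)) x (chartVec φ x b) := by
    intro x hx b
    have hc : ∀ b : Fin n → ℂ,
        mvfderiv (MI n s) (fun y => mvfderiv (MI n s) f y (chartVec φ y a)) x (chartVec φ x b)
          = mvfderiv (MI n s) (fun y => mvfderiv (MI n s) f y (chartVec φ y b)) x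
            (chartVec φ x a) := fun b =>
      mvfderiv_coordField_comm hφm hU hx (hUφ hx) _ _ hf.smooth
    rw [hc, hc]
    have he : (fun y => mvfderiv (MI n s) f y (chartVec φ y (Complex.I • b)))
        =ᶠ[𝓝 x] fun y => Complex.I * mvfderiv (MI n s) f y (chartVec φ y b) := by
      filter_upwards [hU.mem_nhds hx] with y hy
      exact hf.mvfderiv_chartVec hU hy hφ (hUφ hy) _ _
    have h2 : HasMFDerivAt (MI n s) 𝓘(ℝ, ℂ)
        (fun y => mvfderiv (MI n s) f y (chartVec φ y (Complex.I • b))) x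
        ((ContinuousLinearMap.mul ℝ ℂ Complex.I).comp (mfderiv (MI n s) 𝓘(ℝ, ℂ)
          (fun y => mvfderiv (MI n s) f y (chartVec φ y b)) x)) :=
      ((ContinuousLinearMap.mul ℝ ℂ Complex.I).hasMFDerivAt.comp x
        ((hsm b x hx).mdifferentiableAt (by simp)).hasMFDerivAt).congr_of_eventuallyEq he
    exact DFunLike.congr_fun h2.mfderiv _
  -- In another adapted chart the direction is vertical, hence a `φ`-direction, and its
  -- `φ`-components depend complex linearly on `b`.
  intro φ' hφ' x hx hx' b
  rw [← chartVec_dz hφ (hUφ hx) (chartVec_mem_vertical hφ' hx' (Complex.I • b)),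
    dz_chartVec_smul hφ hφ' (hUφ hx) hx', key x hx,
    chartVec_dz hφ (hUφ hx) (chartVec_mem_vertical hφ' hx' b)]

/-- Complex linearity of the change of coordinates on vertical vectors means that the type (1,0)
does not depend on the adapted chart. -/
theorem holVec_eq_holVec (hφ : φ ∈ D.charts) (hφ' : φ' ∈ D.charts) {x : M} (hx : x ∈ φ.source)
    (hx' : x ∈ φ'.source) (a : Fin n → ℂ) :
    holVec φ x a = holVec φ' x (dz φ' x (chartVec φ x a)) := by
  rw [holVec_apply, holVec_apply, ← dz_chartVec_smul hφ' hφ hx' hx]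
  simp only [chartVecₗ_apply, chartVec_dz hφ' hx' (chartVec_mem_vertical hφ hx _)]

/-- The coefficients in another chart are the derivatives `∂z'ₗ/∂zₖ`, which lie in `Õ`; they can be
taken as derivatives in the real direction `∂/∂xₖ` because `z'ₗ` is holomorphic along the fibers. -/
theorem isOField_ddz (hφ : φ ∈ D.charts) (k : Fin n) : D.IsOField φ.source (ddz φ k) := by
  intro φ' hφ'
  refine ⟨fun l y => mvfderiv (MI n s) (fun y => (φ' y).1 l) y (chartVec φ y (Pi.single k 1)),
    fun l => ((isO_coord hφ' l).mono inter_subset_right).deriv_chartVec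
      (φ.open_source.inter φ'.open_source) hφ _ inter_subset_left, fun x hx => ?_⟩
  rw [ddz_eq_holVec, holVec_eq_holVec hφ hφ' hx.1 hx.2, holVec_eq_sum]
  simp only [mvfderiv_coord hφ' hx.2]

theorem ofRealT_eq_of_mem_vertical (hφ : φ ∈ D.charts) {x : M} (hx : x ∈ φ.source)
    {u : TangentSpace (MI n s) x} (hu : u ∈ D.vertical x) :
    ofRealT x u = ∑ k, dz φ x u k • ddz φ k x
      + ∑ k, (starRingEnd ℂ) (dz φ x u k) • ddzbar φ k x := by
  rw [← holVec_eq_sum, ← antiVec_eq_sum, ← ofRealT_chartVec, chartVec_dz hφ hx hu]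

/-! ### Sections of `Õ(Tπ)` and coframes on the fibers -/

variable {X : Π x : M, CTangent n s x}

theorem IsOField.cDiff (hX : D.IsOField U X) (hU : IsOpen U) {x : M} (hx : x ∈ U) : CDiff X x := by
  obtain ⟨φ, hφ, hxφ⟩ := D.cover x
  obtain ⟨f, hf, hXf⟩ := hX φ hφ
  have hUφ := hU.inter φ.open_source
  refine CDiff.congr (CDiff.sum Finset.univ fun k =>
    (CDiff.ddz (D.charts_subset hφ) hxφ k).smul ((hf k).mdifferentiableAt hUφ ⟨hx, hxφ⟩)) ?_
  filter_upwards [hUφ.mem_nhds ⟨hx, hxφ⟩] with y hy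
  exact hXf y hy

/-- For `X = ∑ fₖ ∂/∂zₖ` the bracket is `-∑ (∂fₖ/∂z̄ₗ) ∂/∂zₖ`, because coordinate fields commute,
and this is zero by the Cauchy–Riemann equations. -/
theorem IsOField.cbracket_ddzbar (hX : D.IsOField U X) (hU : IsOpen U) {x : M} (hx : x ∈ U)
    (hφ : φ ∈ D.charts) (hxφ : x ∈ φ.source) (l : Fin n) : cbracket X (ddzbar φ l) x = 0 := by
  obtain ⟨f, hf, hXf⟩ := hX φ hφ
  have hUφ := hU.inter φ.open_source
  have hφm := D.charts_subset hφ
  have hd : ∀ k, CDiff (fun y => f k y • ddz φ k y) x := fun k =>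
    (CDiff.ddz hφm hxφ k).smul ((hf k).mdifferentiableAt hUφ ⟨hx, hxφ⟩)
  have h0 : ∀ k, cbracket (fun y => f k y • ddz φ k y) (ddzbar φ l) x = 0 := fun k => by
    rw [cbracket_smul_left (CDiff.ddz hφm hxφ k) ((hf k).mdifferentiableAt hUφ ⟨hx, hxφ⟩),
      cbracket_ddz_ddzbar hφm hxφ, (hf k).cderiv_ddzbar hUφ ⟨hx, hxφ⟩ hφ hxφ, smul_zero, zero_smul,
      sub_zero]
  have hs : ∀ A : Finset (Fin n),
      cbracket (fun y => ∑ k ∈ A, f k y • ddz φ k y) (ddzbar φ l) x = 0 := fun A => by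
    classical
    induction A using Finset.induction_on with
    | empty =>
      have h := cbracket_smul_left (Z := fun _ => 0) (W := ddzbar φ l) (f := fun _ => 0)
        (CDiff.zero x) mdifferentiableAt_const
      simpa using h
    | insert k A hk ih =>
      simp only [Finset.sum_insert hk]
      rw [cbracket_add_left (hd k) (CDiff.sum A hd), h0, ih, add_zero]
  rw [← hs Finset.univ]
  refine cbracket_congr ?_ (Filter.Eventually.of_forall fun _ => rfl)
  filter_upwards [hUφ.mem_nhds ⟨hx, hxφ⟩] with y hy
  exact hXf y hy

/-- One-forms on the fiber which are the coordinates complementary to the foliation and the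
antiholomorphic directions. -/
theorem exists_coframe {φ : OpenPartialHomeomorph M (Model n s)}
    (hφ : φ ∈ D.charts) {x : M} (hx : x ∈ φ.source) {m p : ℕ} (e : Fin m → CTangent n s x)
    (X : Fin p → CTangent n s x) (g : Fin n → Fin m → ℂ) (h : Fin n → Fin p → ℂ)
    (hgh : ∀ k, ddz φ k x = ∑ i, g k i • e i + ∑ j, h k j • X j) :
    ∃ (θ : Fin m → D.vertical x →ₗ[ℝ] ℂ) (ξ : Fin p ⊕ Fin n → D.vertical x →ₗ[ℝ] ℂ),
      ∀ u : D.vertical x, (1 : ℂ) ⊗ₜ[ℝ] (u : TangentSpace (MI n s) x)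
        = ∑ a, θ a u • e a + ∑ j, ξ j u • Sum.elim X (fun k => ddzbar φ k x) j := by
  let α : Fin n → D.vertical x →ₗ[ℝ] ℂ := fun k =>
    LinearMap.proj k ∘ₗ dz φ x ∘ₗ (D.vertical x).subtype
  -- A vertical vector is `∑ dzₖ(u) ∂/∂zₖ + ∑ conj(dzₖ(u)) ∂/∂z̄ₖ`. Substituting `hgh` in the first
  -- sum gives the coefficients of `e` and `X`; those of the antiholomorphic vectors are the
  -- conjugates of `dzₖ`.
  refine ⟨fun i => ∑ k, g k i • α k,
    Sum.elim (fun j => ∑ k, h k j • α k) fun k => Complex.conjAe.toLinearMap ∘ₗ α k, fun u => ?_⟩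
  have h1 : (1 : ℂ) ⊗ₜ[ℝ] (u : TangentSpace (MI n s) x) = ∑ k, α k u • ddz φ k x
      + ∑ k, (starRingEnd ℂ) (α k u) • ddzbar φ k x :=
    ofRealT_eq_of_mem_vertical hφ hx u.2
  have h2 : ∑ k, α k u • ddz φ k x
      = ∑ i, (∑ k, g k i • α k u) • e i + ∑ j, (∑ k, h k j • α k u) • X j := by
    simp only [hgh, Finset.smul_sum, smul_add, Finset.sum_add_distrib, Finset.sum_smul, smul_smul,
      smul_eq_mul, mul_comm (α _ u)]
    rw [Finset.sum_comm, Finset.sum_comm (f := fun k j => (h k j * α k u) • X j)]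
  rw [h1, h2, Fintype.sum_sum_type, ← add_assoc]
  simp only [Sum.elim_inl, Sum.elim_inr, LinearMap.sum_apply, LinearMap.smul_apply]
  rfl

end

end Deformation

section Stalks

variable {n s : ℕ} {M : Type*} [TopologicalSpace M] [ChartedSpace (Model n s) M]
  [IsManifold (MI n s) ∞ M] {P : Type*} [TopologicalSpace P]
  [ChartedSpace (EuclideanSpace ℝ (Fin s)) P] [IsManifold (𝓡 s) ∞ P]
  {D : Deformation n s M P} {x : M} {f g : M → ℂ}

/-! ### Stalks of the tangent, normal and foliation sheaves -/

namespace Deformation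

theorem oGerm_const (c : ℂ) : D.OGerm x fun _ => c := ⟨univ, isOpen_univ, mem_univ x, isO_const c⟩

theorem OGerm.add (hf : D.OGerm x f) (hg : D.OGerm x g) : D.OGerm x fun y => f y + g y := by
  obtain ⟨U, hU, hxU, hf⟩ := hf
  obtain ⟨V, hV, hxV, hg⟩ := hg
  exact ⟨U ∩ V, hU.inter hV, ⟨hxU, hxV⟩, (hf.mono inter_subset_left).add (hg.mono inter_subset_right)⟩

theorem OGerm.mul (hf : D.OGerm x f) (hg : D.OGerm x g) : D.OGerm x fun y => f y * g y := by
  obtain ⟨U, hU, hxU, hf⟩ := hf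
  obtain ⟨V, hV, hxV, hg⟩ := hg
  exact ⟨U ∩ V, hU.inter hV, ⟨hxU, hxV⟩, (hf.mono inter_subset_left).mul (hg.mono inter_subset_right)⟩

theorem OGerm.sub (hf : D.OGerm x f) (hg : D.OGerm x g) : D.OGerm x fun y => f y - g y := by
  simpa [sub_eq_add_neg] using hf.add ((oGerm_const (-1)).mul hg)

theorem OGerm.sum {κ : Type*} (A : Finset κ) {f : κ → M → ℂ} (hf : ∀ k, D.OGerm x (f k)) :
    D.OGerm x fun y => ∑ k ∈ A, f k y := by
  classical
  induction A using Finset.induction_on with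
  | empty => simpa using oGerm_const (D := D) (x := x) 0
  | insert k A hk ih => simpa only [Finset.sum_insert hk] using (hf k).add ih

end Deformation

namespace Foliation

open TopologicalSpace (Opens)

variable {𝓕 : Foliation D} {X Y : Π x : M, CTangent n s x}

theorem Germ.congr (hX : 𝓕.Germ x X) (h : ∀ᶠ y in 𝓝 x, Y y = X y) : 𝓕.Germ x Y := by
  obtain ⟨U, hxU, hX⟩ := hX
  obtain ⟨V, hV, hVo, hxV⟩ := mem_nhds_iff.1 h
  refine ⟨U ⊓ ⟨V, hVo⟩, ⟨hxU, hxV⟩, ?_⟩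
  exact 𝓕.congr _ X (𝓕.restrict _ _ inf_le_left hX) Y fun y hy => (hV hy.2).symm

theorem Germ.add (hX : 𝓕.Germ x X) (hY : 𝓕.Germ x Y) : 𝓕.Germ x fun y => X y + Y y := by
  obtain ⟨U, hxU, hX⟩ := hX
  obtain ⟨V, hxV, hY⟩ := hY
  exact ⟨U ⊓ V, ⟨hxU, hxV⟩, 𝓕.add_mem _ _ (𝓕.restrict _ _ inf_le_left hX) _
    (𝓕.restrict _ _ inf_le_right hY)⟩

theorem Germ.smul (hf : D.OGerm x f) (hX : 𝓕.Germ x X) : 𝓕.Germ x fun y => f y • X y := by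
  obtain ⟨U, hxU, hX⟩ := hX
  obtain ⟨V, hV, hxV, hf⟩ := hf
  exact ⟨U ⊓ ⟨V, hV⟩, ⟨hxU, hxV⟩, 𝓕.smul_mem _ _ (hf.mono inter_subset_right) _
    (𝓕.restrict _ _ inf_le_left hX)⟩

theorem Germ.sum {κ : Type*} (A : Finset κ) {X : κ → Π x : M, CTangent n s x}
    (hX : ∀ k, 𝓕.Germ x (X k)) : 𝓕.Germ x fun y => ∑ k ∈ A, X k y := by
  classical
  induction A using Finset.induction_on with
  | empty => exact ⟨⊤, trivial, by simpa using 𝓕.zero_mem ⊤⟩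
  | insert k A hk ih => simpa only [Finset.sum_insert hk] using (hX k).add ih

/-- Bases of the stalks of the normal sheaf and of the foliation give a spanning family of the
holomorphic tangent space with at most `n` members. -/
theorem exists_adapted {p : ℕ} (hp : 𝓕.HasRank p) (hx : 𝓕.NormalFree x)
    {φ : OpenPartialHomeomorph M (Model n s)} (hφ : φ ∈ D.charts) (hxφ : x ∈ φ.source) :
    ∃ (m : ℕ) (e : Fin m → CTangent n s x) (X : Fin p → Π x : M, CTangent n s x),
      m + p ≤ n ∧ (∀ j, 𝓕.Germ x (X j)) ∧
      ∃ (g : Fin n → Fin m → ℂ) (h : Fin n → Fin p → ℂ), ∀ k,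
        ddz φ k x = ∑ i, g k i • e i + ∑ j, h k j • X j x := by
  classical
  obtain ⟨X, hX, hXgen, hXind⟩ := hp x (fun h => h hx)
  obtain ⟨m, e, he, hgen, hind⟩ := hx
  let Y : Fin m ⊕ Fin p → Π x : M, CTangent n s x := Sum.elim e X
  have hYfield : ∀ ν, ∃ U : Set M, IsOpen U ∧ x ∈ U ∧ D.IsOField U (Y ν) := by
    rintro (i | j)
    · exact he i
    · obtain ⟨U, hxU, hU⟩ := hX j
      exact ⟨U, U.isOpen, hxU, 𝓕.isOField U _ hU⟩
  -- A relation among all members becomes, modulo `𝓕`, a relation among the normal ones. Their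
  -- coefficients vanish, and what remains is a relation in the basis of `𝓕`.
  have hYind : ∀ c : Fin m ⊕ Fin p → M → ℂ, (∀ ν, D.OGerm x (c ν)) →
      (∀ᶠ y in 𝓝 x, ∑ ν, c ν y • Y ν y = 0) → ∀ ν, ∀ᶠ y in 𝓝 x, c ν y = 0 := by
    intro c hc h0
    simp only [Fintype.sum_sum_type] at h0
    have h1 : ∀ i, ∀ᶠ y in 𝓝 x, c (Sum.inl i) y = 0 := by
      refine hind (fun i => c (Sum.inl i)) (fun i => hc _) ?_
      refine Germ.congr (Germ.sum Finset.univ fun j =>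
        Germ.smul ((Deformation.oGerm_const (-1)).mul (hc (Sum.inr j))) (hX j)) ?_
      filter_upwards [h0] with y hy
      simp only [neg_one_mul, neg_smul, Finset.sum_neg_distrib]
      exact eq_neg_of_add_eq_zero_left hy
    have h2 : ∀ j, ∀ᶠ y in 𝓝 x, c (Sum.inr j) y = 0 := by
      refine hXind (fun j => c (Sum.inr j)) (fun j => hc _) ?_
      filter_upwards [h0, Filter.eventually_all.2 h1] with y hy hy1
      simpa [hy1, Y] using hy
    rintro (i | j)
    · exact h1 i
    · exact h2 j
  -- The coordinate fields are expanded in the combined family: first modulo `𝓕` in the normal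
  -- basis, then the remainder in the basis of `𝓕`.
  have hG : ∀ k, ∃ G : Fin m ⊕ Fin p → M → ℂ, (∀ ν, D.OGerm x (G ν)) ∧
      ∀ᶠ y in 𝓝 x, ddz φ k y = ∑ ν, G ν y • Y ν y := fun k => by
    obtain ⟨g, hg, hgF⟩ := hgen φ.source (ddz φ k) φ.open_source hxφ (Deformation.isOField_ddz hφ k)
    obtain ⟨h, hh, hhX⟩ := hXgen _ hgF
    refine ⟨Sum.elim g h, by rintro (i | j); exacts [hg i, hh j], ?_⟩
    filter_upwards [hhX] with y hy
    rw [Fintype.sum_sum_type]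
    exact (sub_eq_iff_eq_add'.1 hy)
  have hA : ∀ ν, ∃ a : Fin n → M → ℂ, (∀ k, D.OGerm x (a k)) ∧
      ∀ᶠ y in 𝓝 x, Y ν y = ∑ k, a k y • ddz φ k y := fun ν => by
    obtain ⟨U, hU, hxU, hY⟩ := hYfield ν
    obtain ⟨a, ha, haY⟩ := hY φ hφ
    have hUφ := hU.inter φ.open_source
    exact ⟨a, fun k => ⟨_, hUφ, ⟨hxU, hxφ⟩, ha k⟩,
      Filter.mem_of_superset (hUφ.mem_nhds ⟨hxU, hxφ⟩) haY⟩
  choose G hGO hG using hG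
  choose A hAO hA using hA
  -- Expanding `Y ν` in the coordinate fields and these back in `Y` gives a relation with
  -- coefficients `1 - A G`, which vanish by independence of the germs.
  have hAG : ∀ ν μ, ∀ᶠ y in 𝓝 x, (if ν = μ then (1 : ℂ) else 0) - ∑ k, A ν k y * G k μ y = 0 := by
    intro ν
    refine hYind _ (fun μ => (Deformation.oGerm_const _).sub (Deformation.OGerm.sum _ fun k =>
      (hAO ν k).mul (hGO k μ))) ?_
    filter_upwards [hA ν, Filter.eventually_all.2 hG] with y hy hyG
    simp only [sub_smul, Finset.sum_sub_distrib, ite_smul, one_smul, zero_smul, Finset.sum_ite_eq,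
      Finset.mem_univ, if_true, Finset.sum_smul, mul_smul]
    rw [Finset.sum_comm, sub_eq_zero, hy]
    refine Finset.sum_congr rfl fun k _ => ?_
    rw [hyG k, Finset.smul_sum]
  refine ⟨m, fun i => e i x, X, ?_, hX, fun k i => G k (Sum.inl i) x,
    fun k j => G k (Sum.inr j) x, fun k => ?_⟩
  -- Evaluated at `x`, the identity matrix of size `m + p` factors through `ℂⁿ`, so its rank is at
  -- most `n`. This turns independence of germs into a bound at the point.
  · have hmul : (Matrix.of fun ν k => A ν k x) * (Matrix.of fun k μ => G k μ x)
        = (1 : Matrix (Fin m ⊕ Fin p) (Fin m ⊕ Fin p) ℂ) := by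
      ext ν μ
      rw [Matrix.mul_apply, Matrix.one_apply]
      exact (sub_eq_zero.1 (hAG ν μ).self_of_nhds).symm
    have h1 := Matrix.rank_mul_le_left (Matrix.of fun ν k => A ν k x) (Matrix.of fun k μ => G k μ x)
    rw [hmul, Matrix.rank_one] at h1
    simpa using h1.trans (Matrix.rank_le_card_width _)
  · have := (hG k).self_of_nhds
    rwa [Fintype.sum_sum_type] at this

end Foliation

end Stalks

/-! ### Vanishing of the curvature along the foliation and the antiholomorphic directions -/

section Vanishing

theorem complexify₂_compr₂ {T A A' : Type*} [AddCommGroup T] [Module ℝ T] [AddCommGroup A]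
    [Module ℂ A] [AddCommGroup A'] [Module ℂ A'] (B : T →ₗ[ℝ] T →ₗ[ℝ] A) (L : A →ₗ[ℂ] A')
    (z w : ℂ ⊗[ℝ] T) :
    complexify₂ (B.compr₂ (L.restrictScalars ℝ)) z w = L (complexify₂ B z w) := by
  induction z using TensorProduct.induction_on with
  | zero => simp
  | add a b ha hb => simp [ha, hb]
  | tmul c u =>
    induction w using TensorProduct.induction_on with
    | zero => simp
    | add a b ha hb => simp [ha, hb]
    | tmul d v => simp [complexify₂_tmul]

variable {n s : ℕ} {M : Type*} [TopologicalSpace M] [ChartedSpace (Model n s) M]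
  [IsManifold (MI n s) ∞ M] {P : Type*} [TopologicalSpace P]
  [ChartedSpace (EuclideanSpace ℝ (Fin s)) P] [IsManifold (𝓡 s) ∞ P]
  {D : Deformation n s M P} {𝓕 : Foliation D}
  {F : Type*} [NormedAddCommGroup F] [NormedSpace ℂ F]
  {E : M → Type*} [TopologicalSpace (TotalSpace F E)] [∀ x, AddCommGroup (E x)]
  [∀ x, Module ℂ (E x)] [∀ x, TopologicalSpace (E x)] [FiberBundle F E] [VectorBundle ℂ F E]
  {𝓔 : OBundle F E D}

theorem cbracket_swap (Z W : Π x : M, CTangent n s x) (x : M) :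
    cbracket Z W x = - cbracket W Z x := by
  rw [cbracket_eq, cbracket_eq]
  rw [VectorField.mlieBracket_swap_apply (V := fun y => reT y (Z y)) (W := fun y => reT y (W y)),
    VectorField.mlieBracket_swap_apply (V := fun y => imT y (Z y)) (W := fun y => imT y (W y)),
    VectorField.mlieBracket_swap_apply (V := fun y => reT y (Z y)) (W := fun y => imT y (W y)),
    VectorField.mlieBracket_swap_apply (V := fun y => imT y (Z y)) (W := fun y => reT y (W y))]
  simp only [map_neg]
  module

/-! ### `Õ`-sections of the bundle -/

namespace OBundle

theorem IsOSec.mono {U V : Set M} {σ : Π x : M, E x} (hσ : 𝓔.IsOSec U σ) (h : V ⊆ U) :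
    𝓔.IsOSec V σ := fun e he => by
  obtain ⟨f, hf, hσf⟩ := hσ e he
  exact ⟨f, fun k => (hf k).mono (inter_subset_inter_left _ h), fun x hx => hσf x ⟨h hx.1, hx.2⟩⟩

theorem isOSec_sum_const {e} (he : e ∈ 𝓔.frames) (c : Fin (Module.finrank ℂ F) → ℂ) :
    𝓔.IsOSec e.1 fun y => ∑ j, c j • e.2 j y := fun e' he' => by
  obtain ⟨g, hg, hge⟩ := 𝓔.transition e' he' e he
  refine ⟨fun i y => ∑ j, c j * g i j y, fun i => Deformation.IsO.sum _ fun j =>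
    (Deformation.isO_const _).mul ((hg i j).mono fun y hy => ⟨hy.2, hy.1⟩), fun x hx => ?_⟩
  simp only [hge x ⟨hx.2, hx.1⟩, Finset.smul_sum, Finset.sum_smul, mul_smul]
  exact Finset.sum_comm

/-- The extension hypotheses describe `∇` on `Õ`-sections. By tensoriality, extending each fiber
vector to one of them is enough to compute the curvature. -/
theorem exists_isOSec_eq {x : M} {e} (he : e ∈ 𝓔.frames) (hx : x ∈ e.1) (v : E x) :
    ∃ σ : Π x : M, E x, 𝓔.IsOSec e.1 σ ∧ σ x = v := by
  have hv : v ∈ Submodule.span ℂ (range fun j => e.2 j x) := by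
    rw [𝓔.span_eq_top e he x hx]
    trivial
  obtain ⟨c, hc⟩ := (Submodule.mem_span_range_iff_exists_fun ℂ).1 hv
  exact ⟨_, isOSec_sum_const he c, hc⟩

variable [∀ x, IsTopologicalAddGroup (E x)] [∀ x, ContinuousSMul ℝ (E x)] [VectorBundle ℝ F E]

theorem smoothSecOn_sum {U : Set M} {e} (he : e ∈ 𝓔.frames) (hU : U ⊆ e.1)
    {f : Fin (Module.finrank ℂ F) → M → ℂ}
    (hf : ∀ j, ContMDiffOn (MI n s) 𝓘(ℝ, ℂ) ∞ (f j) U) :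
    SmoothSecOn F E (n := n) (s := s) U fun y => ∑ j, f j y • e.2 j y :=
  ContMDiffOn.sum_section fun j _ =>
    SmoothSecOn.complex_smul (hf j) ((𝓔.smooth e he j).mono hU)

theorem IsOSec.smoothSecOn {U : Set M} (hU : IsOpen U) {σ : Π x : M, E x} (hσ : 𝓔.IsOSec U σ) :
    SmoothSecOn F E (n := n) (s := s) U σ := fun x hx => by
  obtain ⟨e, he, hxe⟩ := 𝓔.cover x
  obtain ⟨f, hf, hσf⟩ := hσ e he
  have hV := (hU.inter e.1.isOpen).mem_nhds ⟨hx, hxe⟩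
  have h := (smoothSecOn_sum he inter_subset_right fun j => (hf j).smooth).contMDiffAt hV
  refine (h.congr_of_eventuallyEq ?_).contMDiffWithinAt
  filter_upwards [hV] with y hy
  rw [hσf y hy]

end OBundle

variable [∀ x, IsTopologicalAddGroup (E x)] [∀ x, ContinuousSMul ℝ (E x)] [VectorBundle ℝ F E]
  {δ : FlatPartialConnection 𝓕 𝓔} {nabla : Connection n s F E}

/-! ### Curvature of a connection that extends `δ ⊕ ∂̄` -/

namespace Connection

theorem along_zero (nabla : Connection n s F E) (x : M) :
    nabla.along (fun _ => 0) x = 0 := by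
  have h0 : SmoothSecOn F E (n := n) (s := s) univ (fun _ => 0) :=
    (contMDiff_zeroSection ℝ E).contMDiffOn
  ext u
  have h := nabla.toFun_const_smul (h0.diffSec isOpen_univ (mem_univ x)) 0 u
  simp only [smul_zero, zero_smul] at h
  exact (nabla.along_ofRealT _ x u).trans h

theorem along_eq_zero (nabla : Connection n s F E) {σ : Π x : M, E x} {x : M}
    (hσ : DiffSec (n := n) (s := s) F σ x) (h : ∀ᶠ y in 𝓝 x, σ y = 0) : nabla.along σ x = 0 := by
  have h0 : SmoothSecOn F E (n := n) (s := s) univ (fun _ => 0) :=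
    (contMDiff_zeroSection ℝ E).contMDiffOn
  rw [nabla.along_congr hσ (h0.diffSec isOpen_univ (mem_univ x)) h, along_zero]

/-- The coefficients of the section in an `Õ`-frame satisfy the Cauchy–Riemann equations, so `∂̄`
annihilates it. -/
theorem Extends.along_ddzbar (hext : nabla.Extends δ) {U : Set M} (hU : IsOpen U)
    {σ : Π x : M, E x} (hσ : 𝓔.IsOSec U σ) {φ : OpenPartialHomeomorph M (Model n s)}
    (hφ : φ ∈ D.charts) {x : M} (hx : x ∈ U) (hxφ : x ∈ φ.source) (k : Fin n) :
    nabla.along σ x (ddzbar φ k x) = 0 := by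
  obtain ⟨e, he, hxe⟩ := 𝓔.cover x
  obtain ⟨f, hf, hσf⟩ := hσ e he
  -- The formula for `∂̄` requires an open set that lies in both the chart and the frame domain.
  let V : TopologicalSpace.Opens M :=
    ⟨U ∩ e.1 ∩ φ.source, (hU.inter e.1.isOpen).inter φ.open_source⟩
  have hxV : x ∈ V := ⟨⟨hx, hxe⟩, hxφ⟩
  have hfV : ∀ j, D.IsO V (f j) := fun j => (hf j).mono inter_subset_left
  have hV : (V : Set M) ∈ 𝓝 x := V.isOpen.mem_nhds hxV
  have hs : SmoothSecOn F E (n := n) (s := s) V fun y => ∑ j, f j y • e.2 j y :=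
    OBundle.smoothSecOn_sum he (fun y hy => hy.1.2) fun j => (hfV j).smooth
  rw [nabla.along_congr ((hσ.smoothSecOn hU).diffSec hU hx) (hs.diffSec V.isOpen hxV)
    (Filter.mem_of_superset hV fun y hy => hσf y hy.1),
    hext.dbar V φ hφ e he (fun y hy => ⟨hy.2, hy.1.2⟩) f (fun j => (hfV j).smooth) x hxV k]
  refine Finset.sum_eq_zero fun j _ => ?_
  rw [(hfV j).cderiv_ddzbar V.isOpen hxV hφ hxφ, zero_smul]

variable {U : TopologicalSpace.Opens M} {X Y : Π x : M, CTangent n s x} {σ : Π x : M, E x} {x : M}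
  {φ : OpenPartialHomeomorph M (Model n s)}

/-- The inner derivative agrees with `δ_X σ` on a whole neighbourhood, so it may be replaced before
differentiating again. -/
theorem Extends.along_along_sec (hext : nabla.Extends δ) (hX : X ∈ 𝓕.sec U)
    (hσ : 𝓔.IsOSec U σ) (hx : x ∈ U) :
    nabla.along (fun y => nabla.along σ y (X y)) x = nabla.along (δ.toFun X σ) x := by
  refine nabla.along_congr (nabla.diffSec_along U.isOpen (hσ.smoothSecOn U.isOpen) hx
    ((𝓕.isOField U X hX).cDiff U.isOpen hx))
    (((δ.isOSec U X hX σ hσ).smoothSecOn U.isOpen).diffSec U.isOpen hx) ?_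
  filter_upwards [U.isOpen.mem_nhds hx] with y hy
  exact hext.delta U X hX σ hσ y hy

/-- Since `δ` preserves `Õ`-sections and `𝓕` is closed under brackets, all three terms are values of
`δ`, and their combination is the curvature of `δ`. -/
theorem Extends.ccurv_sec_sec (hext : nabla.Extends δ) (hX : X ∈ 𝓕.sec U) (hY : Y ∈ 𝓕.sec U)
    (hσ : 𝓔.IsOSec U σ) (hx : x ∈ U) : nabla.ccurv σ x X Y = 0 := by
  rw [ccurv, hext.along_along_sec hX hσ hx, hext.along_along_sec hY hσ hx,
    hext.delta U X hX _ (δ.isOSec U Y hY σ hσ) x hx,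
    hext.delta U Y hY _ (δ.isOSec U X hX σ hσ) x hx,
    hext.delta U _ (𝓕.bracket_mem U X hX Y hY) σ hσ x hx]
  exact δ.flat U X hX Y hY σ hσ x hx

theorem Extends.along_along_ddzbar (hext : nabla.Extends δ) (hσ : 𝓔.IsOSec U σ) (hφ : φ ∈ D.charts)
    (hx : x ∈ U) (hxφ : x ∈ φ.source) (k : Fin n) :
    nabla.along (fun y => nabla.along σ y (ddzbar φ k y)) x = 0 := by
  refine nabla.along_eq_zero (nabla.diffSec_along U.isOpen (hσ.smoothSecOn U.isOpen) hx
    (CDiff.ddzbar (D.charts_subset hφ) hxφ k)) ?_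
  filter_upwards [U.isOpen.mem_nhds hx, φ.open_source.mem_nhds hxφ] with y hy hyφ
  exact hext.along_ddzbar U.isOpen hσ hφ hy hyφ k

theorem Extends.ccurv_ddzbar_ddzbar (hext : nabla.Extends δ) (hσ : 𝓔.IsOSec U σ)
    (hφ : φ ∈ D.charts) (hx : x ∈ U) (hxφ : x ∈ φ.source) (k l : Fin n) :
    nabla.ccurv σ x (ddzbar φ k) (ddzbar φ l) = 0 := by
  rw [ccurv, hext.along_along_ddzbar hσ hφ hx hxφ, hext.along_along_ddzbar hσ hφ hx hxφ,
    cbracket_ddzbar_ddzbar (D.charts_subset hφ) hxφ, map_zero]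
  simp

/-- Each term vanishes separately: `σ` and `δ_X σ` are `Õ`-sections, hence annihilated by `∇` along
`∂/∂z̄ₗ`, and the bracket is zero. -/
theorem Extends.ccurv_sec_ddzbar (hext : nabla.Extends δ) (hX : X ∈ 𝓕.sec U) (hσ : 𝓔.IsOSec U σ)
    (hφ : φ ∈ D.charts) (hx : x ∈ U) (hxφ : x ∈ φ.source) (l : Fin n) :
    nabla.ccurv σ x X (ddzbar φ l) = 0 := by
  rw [ccurv, hext.along_along_ddzbar hσ hφ hx hxφ, hext.along_along_sec hX hσ hx,
    hext.along_ddzbar U.isOpen (δ.isOSec U X hX σ hσ) hφ hx hxφ,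
    (𝓕.isOField U X hX).cbracket_ddzbar U.isOpen hx hφ hxφ, map_zero]
  simp

theorem ccurv_swap (nabla : Connection n s F E) (σ : Π x : M, E x) (x : M)
    (Z W : Π y : M, CTangent n s y) : nabla.ccurv σ x Z W = - nabla.ccurv σ x W Z := by
  rw [ccurv, ccurv, cbracket_swap, map_neg]
  abel

theorem Extends.complexify₂_curvLin_eq_zero (hext : nabla.Extends δ) {p : ℕ}
    {X : Fin p → Π x : M, CTangent n s x} (hX : ∀ j, 𝓕.Germ x (X j)) (hφ : φ ∈ D.charts)
    (hxφ : x ∈ φ.source) (hσ : 𝓔.IsOSec U σ) (hx : x ∈ U) (j j' : Fin p ⊕ Fin n) :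
    complexify₂ (nabla.curvLin U.isOpen (hσ.smoothSecOn U.isOpen) hx)
      (Sum.elim (fun j => X j x) (fun k => ddzbar φ k x) j)
      (Sum.elim (fun j => X j x) (fun k => ddzbar φ k x) j') = 0 := by
  have key : ∀ {Z W : Π x : M, CTangent n s x}, CDiff Z x → CDiff W x →
      nabla.ccurv σ x Z W = 0 → complexify₂ (nabla.curvLin U.isOpen (hσ.smoothSecOn U.isOpen) hx)
        (Z x) (W x) = 0 := fun hZ hW h0 => by
    rw [← nabla.ccurv_eq U.isOpen (hσ.smoothSecOn U.isOpen) hx hZ hW, h0]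
  have hbar := fun k => CDiff.ddzbar (D.charts_subset hφ) hxφ k
  choose V hxV hXV using hX
  have hXd : ∀ j, CDiff (X j) x := fun j => (𝓕.isOField _ _ (hXV j)).cDiff (V j).isOpen (hxV j)
  have hXbar : ∀ j k, nabla.ccurv σ x (X j) (ddzbar φ k) = 0 := fun j k =>
    -- Each germ is defined on its own open set, so the section of `𝓕` and `σ` are restricted to a
    -- common one.
    hext.ccurv_sec_ddzbar (U := V j ⊓ U) (𝓕.restrict _ _ inf_le_left (hXV j))
      (hσ.mono inter_subset_right) hφ ⟨hxV j, hx⟩ hxφ k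
  rcases j with j | k <;> rcases j' with j' | k'
  · exact key (hXd j) (hXd j') (hext.ccurv_sec_sec (U := V j ⊓ V j' ⊓ U)
      (𝓕.restrict _ _ (inf_le_left.trans inf_le_left) (hXV j))
      (𝓕.restrict _ _ (inf_le_left.trans inf_le_right) (hXV j'))
      (hσ.mono inter_subset_right) ⟨⟨hxV j, hxV j'⟩, hx⟩)
  · exact key (hXd j) (hbar k') (hXbar j k')
  · exact key (hbar k) (hXd j') (by rw [ccurv_swap, hXbar, neg_zero])
  · exact key (hbar k) (hbar k') (hext.ccurv_ddzbar_ddzbar hσ hφ hx hxφ k k')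

/-- The curvature is defined with a standard extension of `b j`. Tensoriality replaces it by a
section `σ` of choice and presents the entry as the two-form of a bilinear map. -/
theorem curvatureMatrix_apply [FiniteDimensional ℂ F] [ContMDiffVectorBundle ∞ F E (MI n s)]
    (hσ : SmoothSecOn F E (n := n) (s := s) U σ) (hx : x ∈ U) {ι : Type*}
    (b : Module.Basis ι ℂ (E x)) {j : ι} (hj : σ x = b j) (i : ι) :
    nabla.curvatureMatrix b i j = twoForm fun u v =>
      (nabla.curvLin U.isOpen hσ hx).compr₂ ((b.coord i).restrictScalars ℝ) u v := by
  rw [curvatureMatrix, Matrix.of_apply]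
  congr 1
  funext u v
  rw [← hj, nabla.curvature_eq_curvHom U.isOpen hσ hx]
  rfl

-- Each column of the matrix uses its own `Õ`-section through `b j`, while the one-forms `θ` depend
-- only on the tangent directions and serve for all entries at once.
set_option maxHeartbeats 1000000 in
theorem Extends.restrictEven_curvatureMatrix_mem [FiniteDimensional ℂ F]
    [ContMDiffVectorBundle ∞ F E (MI n s)] (hext : nabla.Extends δ) {p m : ℕ}
    {X : Fin p → Π x : M, CTangent n s x} (hX : ∀ j, 𝓕.Germ x (X j)) (hφ : φ ∈ D.charts)
    (hxφ : x ∈ φ.source) {e : Fin m → CTangent n s x} {θ : Fin m → D.vertical x →ₗ[ℝ] ℂ}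
    {ξ : Fin p ⊕ Fin n → D.vertical x →ₗ[ℝ] ℂ}
    (hθ : ∀ u : D.vertical x, (1 : ℂ) ⊗ₜ[ℝ] (u : TangentSpace (MI n s) x)
      = ∑ a, θ a u • e a + ∑ j, ξ j u • Sum.elim (fun j => X j x) (fun k => ddzbar φ k x) j)
    {ι : Type*} (b : Module.Basis ι ℂ (E x)) (i j : ι) :
    restrictEven (D.vertical x) (nabla.curvatureMatrix b i j) ∈ wedgeIdeal θ := by
  obtain ⟨fr, hfr, hxfr⟩ := 𝓔.cover x
  obtain ⟨σ, hσ, hσx⟩ := OBundle.exists_isOSec_eq hfr hxfr (b j)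
  rw [nabla.curvatureMatrix_apply (hσ.smoothSecOn fr.1.isOpen) hxfr b hσx i]
  refine restrictEven_twoForm_mem (D.vertical x) _ e _ θ ξ hθ fun j j' => ?_
  rw [complexify₂_compr₂, hext.complexify₂_curvLin_eq_zero hX hφ hxφ hσ hxfr, map_zero]

set_option maxHeartbeats 1000000 in
/-- The curvature matrix, restricted to the fibers, has entries in the ideal generated by one-forms
that vanish on the foliation. -/
theorem Extends.exists_restrictEven_curvatureMatrix_mem [FiniteDimensional ℂ F]
    [ContMDiffVectorBundle ∞ F E (MI n s)] (hext : nabla.Extends δ) {p : ℕ} (hp : 𝓕.HasRank p)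
    (hx : 𝓕.NormalFree x) {ι : Type*} (b : Module.Basis ι ℂ (E x)) :
    ∃ (m : ℕ) (θ : Fin m → D.vertical x →ₗ[ℝ] ℂ), m + p ≤ n ∧ ∀ i j,
      restrictEven (D.vertical x) (nabla.curvatureMatrix b i j) ∈ wedgeIdeal θ := by
  obtain ⟨φ, hφ, hxφ⟩ := D.cover x
  obtain ⟨m, e, X, hmp, hX, g, h, hgh⟩ := Foliation.exists_adapted hp hx hφ hxφ
  obtain ⟨θ, hθ⟩ := Deformation.exists_coframe hφ hxφ e (fun j => X j x) g h hgh
  exact ⟨m, θ, hmp, hθ.elim fun ξ hξ => hext.restrictEven_curvatureMatrix_mem hX hφ hxφ hξ b⟩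

end Connection

end Vanishing

end DefFol

/-! ### Relative Bott vanishing -/

theorem theorem4p1 {n s : ℕ}
    {M : Type*} [TopologicalSpace M] [ChartedSpace (DefFol.Model n s) M]
    [IsManifold (DefFol.MI n s) ∞ M]
    {P : Type*} [TopologicalSpace P] [ChartedSpace (EuclideanSpace ℝ (Fin s)) P]
    [IsManifold (𝓡 s) ∞ P]
    (D : DefFol.Deformation n s M P)
    (𝓕 : DefFol.Foliation D) (p : ℕ) (hp : 𝓕.HasRank p) (hS : 𝓕.singularSet = ∅)
    {F : Type*} [NormedAddCommGroup F] [NormedSpace ℂ F] [FiniteDimensional ℂ F]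
    {E : M → Type*} [TopologicalSpace (TotalSpace F E)] [∀ x, AddCommGroup (E x)]
    [∀ x, Module ℂ (E x)] [∀ x, TopologicalSpace (E x)] [∀ x, IsTopologicalAddGroup (E x)]
    [∀ x, ContinuousSMul ℝ (E x)] [FiberBundle F E] [VectorBundle ℂ F E] [VectorBundle ℝ F E]
    [ContMDiffVectorBundle ∞ F E (DefFol.MI n s)]
    (𝓔 : DefFol.OBundle F E D) (δ : DefFol.FlatPartialConnection 𝓕 𝓔)
    (nabla : DefFol.Connection n s F E) (hext : nabla.Extends δ)
    {N d : ℕ} (φ : MvPolynomial (Fin N) ℂ) (hφ : φ.IsSymmetric) (hdeg : φ.IsHomogeneous d)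
    (hd : (d : ℤ) > (n : ℤ) - (p : ℤ))
    (t : P) (x : M) (hx : D.proj x = t)
    {ι : Type*} [Fintype ι] [DecidableEq ι] (b : Module.Basis ι ℂ (E x)) :
    DefFol.restrictForm (D.vertical x)
      (nabla.charForm b φ hφ : DefFol.FormAlg (TangentSpace (DefFol.MI n s) x)) = 0 := by
  have hx' : 𝓕.NormalFree x := by
    by_contra h
    exact (Set.eq_empty_iff_forall_notMem.1 hS x) h
  obtain ⟨m, θ, hmp, hθ⟩ := hext.exists_restrictEven_curvatureMatrix_mem hp hx' b
  -- The bound `m + p ≤ n` and the integer inequality `d > n - p` give `m < d`, which makes the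
  -- `d`-th power of the ideal zero.
  exact DefFol.restrictForm_symmForm_eq_zero (D.vertical x) (nabla.curvatureMatrix b) θ hθ φ hφ
    hdeg (by omega)
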